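/- **Theorem 1.3.** *Setting.* Let $\Gamma$ be a finite tree with integer vertex weights $m_v$ and a distinguished vertex $v_0$ of degree $1$; let $M$ be its linking matrix ($M_{vv}=m_v$, $M_{uv}=1$ if $u,v$ are adjacent, $0$ otherwise), $\hat M$ the matrix of $\Gamma\setminus v_0$, and $Y$ the complement of the knot $K$ presented by $v_0$ in the plumbed manifold of $\Gamma\setminus v_0$. Assume that $\hat M$ is negative definite and unimodular and that the framing $m_{v_0}$ is the Seifert framing, i.e. $Me_{v_0}=Mw$ for some integer vector $w$ with $w_{v_0}=0$. A relative $\mathrm{Spin}^c$ structure on $Y$ is a class of integer vectors $\vec a$ with $a_v\equiv\deg v\pmod 2$, modulo the vectors $2Mw$ with $w_{v_0}=0$. Let $\vec a$ represent the self-conjugate one ($a=-a$); then $\vec a=M\vec b$ with $\vec b$ integral, $b_{v_0}=0$. With $x=z^2$, $\pi$ the number of positive eigenvalues and $\sigma$ the signature of $M$, the series of $K$ is $$F_K(x,q)=(-1)^{\pi}q^{\frac{3\sigma-\sum_v m_v}{4}}\sum_{\vec n:\ n_{v_0}=n} q^{-\frac{(2\vec n+\vec b,\,M(2\vec n+\vec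 b))}{4}}\,z^{\ell_{v_0}}\prod_{v\ne v_0}\mathrm{v.p.}\oint_{|z_v|=1}\frac{dz_v}{2\pi i z_v}\Bigl(z_v-\frac1{z_v}\Bigr)^{2-\deg v}z_v^{\ell_v},\qquad \vec\ell=M(2\vec n+\vec b),$$ where $n\in\mathbb Z$ is any fixed integer, $\vec n$ runs over integer vectors, and v.p. takes the constant coefficient of the average of the expansions at $z_v\to0$ and $z_v\to\infty$. *Torus knots.* Let $s,t>1$ be integers with $\gcd(s,t)=1$, and let $t'\in(0,t)$, $s'\in(0,s)$ be the integers with $st'\equiv-1\pmod t$ and $ts'\equiv-1\pmod s$. The complement of the positive torus knot $T(s,t)$, with Seifert framing, is presented by the star-shaped tree with central weight $-1$, two legs whose weights (read from the centre) are the entries of continued fractions $k_1-\cfrac{1}{k_2-\cdots}$ of $-t/t'$ and $-s/s'$ with negative entries, chosen so that $\Gamma\setminus v_0$ is negative definite, and $v_0$, of weight $-st$, joined to the centre. *Claim.* Such a choice of continued fractions exists, and for every such choice the resulting $(\Gamma,v_0)$ satisfies the assumptions above, a self-conjugate relative $\mathrm{Spin}^c$ structure exists, the series $F_K$ of $K=T(s,t)$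 is well defined as a formal series in $q$ with Laurent polynomial coefficients in $x^{1/2}$, does not depend on $n$ or on the representative $\vec a$, and $$F_K(x,q)=q^{\frac{(s-1)(t-1)}{2}}\cdot\frac12\sum_{m\ge1}\varepsilon_m\bigl(x^{\frac m2}-x^{-\frac m2}\bigr)q^{\frac{m^2-(st-s-t)^2}{4st}},$$ where $$\varepsilon_m=\begin{cases}-1&\text{if } m\equiv st+s+t\ \text{or}\ st-s-t\pmod{2st},\\ +1&\text{if } m\equiv st+s-t\ \text{or}\ st-s+t\pmod{2st},\\ 0&\text{otherwise.}\end{cases}$$ -/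

import Mathlib

namespace PlumbedKnot

noncomputable section

/-! ### Series in `q` and `x^{1/2}` -/

/-- Formal series in rational powers of `q` whose coefficients are Laurent polynomials over `ℚ` in
`z = x^{1/2}`; thus `x^{k/2}` is `LaurentPolynomial.T k` and `q^e` is `HahnSeries.single e 1`. -/
abbrev QSeries : Type := HahnSeries ℚ (LaurentPolynomial ℚ)

/-- `F` is the formal sum of the family `f`: the exponents of `q` occurring in the family form a
well-ordered set, every power of `q` occurs in only finitely many members, and the members add up
to `F` coefficient by coefficient. -/
def IsFormalSum {ι : Type} (f : ι → QSeries) (F : QSeries) : Prop :=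
  ∃ S : HahnSeries.SummableFamily ℚ (LaurentPolynomial ℚ) ι, (∀ i, S i = f i) ∧ S.hsum = F

/-- The coefficient of `z^j` in the principal value of `(z - 1/z)^k`, i.e. in the average of the
expansions of `(z - 1/z)^k` at `z → 0` (a Laurent series in `z`) and at `z → ∞` (a Laurent series
in `w = 1/z`, where `z - 1/z = 1/w - w` and `z^j = w^{-j}`). -/
def pvCoeff (k j : ℤ) : ℚ :=
  (1 / 2) *
    (((HahnSeries.single 1 1 - HahnSeries.single (-1) 1 : LaurentSeries ℚ) ^ k).coeff j +
      ((HahnSeries.single (-1) 1 - HahnSeries.single 1 1 : LaurentSeries ℚ) ^ k).coeff (-j))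

/-! ### Plumbing graphs with a distinguished vertex -/

/-- A graph with integer weights (framings) on the vertices and a distinguished vertex `v₀`. -/
structure Graph (V : Type) where
  graph : SimpleGraph V
  weight : V → ℤ
  root : V

namespace Graph

variable {V : Type} [Fintype V]

open Classical in
/-- The degree of a vertex. -/
def deg (Γ : Graph V) (v : V) : ℕ := Γ.graph.degree v

open Classical in
/-- The linking (framing) matrix `M`. -/
def M (Γ : Graph V) : Matrix V V ℤ :=
  Matrix.of fun u v => if u = v then Γ.weight u else if Γ.graph.Adj u v then 1 else 0

/-- The linking matrix of the graph with the distinguished vertex deleted. -/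
def Mhat (Γ : Graph V) : Matrix {v : V // v ≠ Γ.root} {v : V // v ≠ Γ.root} ℤ :=
  Γ.M.submatrix Subtype.val Subtype.val

open Classical in
/-- The real quadratic form of `M`. -/
def form (Γ : Graph V) : QuadraticForm ℝ (V → ℝ) :=
  (Γ.M.map (Int.cast : ℤ → ℝ)).toQuadraticForm'

/-- The number `π` of positive eigenvalues of `M` (Mathlib's positive index of inertia). -/
def posIndex (Γ : Graph V) : ℕ := sigPos Γ.form

/-- The signature `σ` of `M`: positive minus negative eigenvalues. -/
def signature (Γ : Graph V) : ℤ := (sigPos Γ.form : ℤ) - (sigNeg Γ.form : ℤ)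

/-- The graph without `v₀` is negative definite. -/
def HatNegDef (Γ : Graph V) : Prop := (-(Γ.Mhat.map (Int.cast : ℤ → ℝ))).PosDef

open Classical in
/-- `Γ` is a plumbing tree, `v₀` has degree one, the plumbing without `v₀` is negative definite and
presents an integer homology sphere (`ℤ^{s-1} / M̂ ℤ^{s-1} = 0`), and the graph longitude `M e_{v₀}`
of the knot is its Seifert longitude, i.e. vanishes in `H₁` of the complement, which is
`ℤ^s / M ℤ^{s-1}` with `ℤ^{s-1} = {w | w v₀ = 0}`. -/
structure IsSeifertFramed (Γ : Graph V) : Prop where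
  isTree : Γ.graph.IsTree
  root_deg : Γ.deg Γ.root = 1
  negDef : Γ.HatNegDef
  homologySphere : IsUnit Γ.Mhat.det
  seifert : ∃ w : V → ℤ, w Γ.root = 0 ∧ Γ.M.mulVec (Pi.single Γ.root 1) = Γ.M.mulVec w

/-- The vector `a` represents a relative `Spin^c` structure: `a ∈ 2ℤ^s + δ`. -/
def IsRelSpinc (Γ : Graph V) (a : V → ℤ) : Prop := ∀ v, a v ≡ (Γ.deg v : ℤ) [ZMOD 2]

/-- Two vectors represent the same relative `Spin^c` structure: they agree modulo
`2M ℤ^{s-1}`. -/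
def SameSpinc (Γ : Graph V) (a a' : V → ℤ) : Prop :=
  ∃ w : V → ℤ, w Γ.root = 0 ∧ a - a' = (2 : ℤ) • Γ.M.mulVec w

/-- The vector `a` represents a self-conjugate relative `Spin^c` structure. -/
def IsSelfConj (Γ : Graph V) (a : V → ℤ) : Prop := Γ.IsRelSpinc a ∧ Γ.SameSpinc a (-a)

open Classical in
/-- The contribution of `k` (the summation vector, written `n⃗` in the theta function) to the
integral `∮ ∏_{v ≠ v₀} dz_v/(2πi z_v) (z_v - 1/z_v)^{2 - deg v} · Θ`, multiplied by
`(z - 1/z)^{1 - deg v₀}`. Here `ℓ = M (2k + b)`, the theta function has the term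
`q^{-(2k+b, M(2k+b))/4} ∏_v z_v^{ℓ_v}`, and the (principal value) integral takes the constant
coefficient in each `z_v`, `v ≠ v₀`. Meant for `deg v₀ ≤ 1`. -/
def term (Γ : Graph V) (b k : V → ℤ) : QSeries :=
  let y : V → ℤ := (2 : ℤ) • k + b
  let l : V → ℤ := Γ.M.mulVec y
  HahnSeries.single (-((y ⬝ᵥ l : ℤ) : ℚ) / 4)
    (LaurentPolynomial.C (∏ v ∈ Finset.univ.erase Γ.root, pvCoeff (2 - (Γ.deg v : ℤ)) (-(l v))) *
      LaurentPolynomial.T (l Γ.root) *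
      (LaurentPolynomial.T 1 - LaurentPolynomial.T (-1)) ^ (1 - Γ.deg Γ.root))

/-- The prefactor `(-1)^π q^{(3σ - ∑ m_v)/4}`. -/
def prefactor (Γ : Graph V) : QSeries :=
  HahnSeries.single ((3 * (Γ.signature : ℚ) - ∑ v, (Γ.weight v : ℚ)) / 4)
    (LaurentPolynomial.C ((-1) ^ Γ.posIndex))

/-- `F = Ẑ_a(Y; z, n, q)`, for `a` represented by the vector `M b`: the sum runs over all integer
vectors whose entry at `v₀` is `n`. -/
def IsZhat (Γ : Graph V) (b : V → ℤ) (n : ℤ) (F : QSeries) : Prop :=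
  ∃ S : QSeries, IsFormalSum (fun k : {k : V → ℤ // k Γ.root = n} => Γ.term b k.1) S ∧
    F = Γ.prefactor * S

/-- `F` is the series `F_K(x, q) = Ẑ_0(Y; x^{1/2}, n, q)` of the knot presented by `(Γ, v₀)`: the
presentation is Seifert framed as above, a self-conjugate relative `Spin^c` structure exists, and
for each of its representatives `a`, which are of the form `M b` with `b v₀ = 0`, and for each `n`,
the sum defining `Ẑ_0(Y; z, n, q)` makes sense and equals `F`. -/
def IsKnotSeries (Γ : Graph V) (F : QSeries) : Prop :=
  Γ.IsSeifertFramed ∧ (∃ a, Γ.IsSelfConj a) ∧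
    ∀ a, Γ.IsSelfConj a →
      (∃ b : V → ℤ, b Γ.root = 0 ∧ a = Γ.M.mulVec b) ∧
      ∀ b : V → ℤ, b Γ.root = 0 → a = Γ.M.mulVec b → ∀ n : ℤ, Γ.IsZhat b n F

end Graph

/-! ### Plumbing diagrams of torus knots -/

/-- The continued fraction `k₁ - 1/(k₂ - 1/(⋯ - 1/k_r))`; since `0⁻¹ = 0`, the value on `[k]`
is `k`. -/
def contFrac : List ℤ → ℚ
  | [] => 0
  | k :: ks => k - (contFrac ks)⁻¹

/-- Vertices of a star with two legs of lengths `p`, `r`, a central vertex and one further vertex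
(the distinguished one). -/
abbrev StarVert (p r : ℕ) : Type := (Unit ⊕ Unit) ⊕ (Fin p ⊕ Fin r)

namespace StarVert

variable {p r : ℕ}

abbrev center : StarVert p r := Sum.inl (Sum.inl ())
abbrev knot : StarVert p r := Sum.inl (Sum.inr ())
abbrev legA (i : Fin p) : StarVert p r := Sum.inr (Sum.inl i)
abbrev legB (j : Fin r) : StarVert p r := Sum.inr (Sum.inr j)

/-- Edges of the star (each listed in one direction): the centre is joined to the distinguished
vertex and to the first vertex of each leg; consecutive vertices of a leg are joined. -/
inductive Edge : StarVert p r → StarVert p r → Prop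
  | knot : Edge center knot
  | startA (i : Fin p) (h : i.val = 0) : Edge center (legA i)
  | startB (j : Fin r) (h : j.val = 0) : Edge center (legB j)
  | stepA (i i' : Fin p) (h : i.val + 1 = i'.val) : Edge (legA i) (legA i')
  | stepB (j j' : Fin r) (h : j.val + 1 = j'.val) : Edge (legB j) (legB j')

end StarVert

/-- The star-shaped plumbing graph with central weight `-1`, legs with weights `A` and `B` (read
from the centre), and the distinguished vertex, of weight `-st`, attached to the centre. -/
def torusGraph (s t : ℕ) (A B : List ℤ) : Graph (StarVert A.length B.length) where
  graph := SimpleGraph.fromRel StarVert.Edge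
  weight
    | Sum.inl (Sum.inl _) => -1
    | Sum.inl (Sum.inr _) => -((s : ℤ) * (t : ℤ))
    | Sum.inr (Sum.inl i) => A.get i
    | Sum.inr (Sum.inr j) => B.get j
  root := StarVert.knot

/-- `A`, `B` are the labels of the legs of a plumbing diagram of the positive torus knot `T(s,t)`:
with `t' ∈ (0,t)`, `s' ∈ (0,s)` such that `st' ≡ -1 (mod t)` and `ts' ≡ -1 (mod s)`, they are
continued fractions of `-t/t'` and `-s/s'` with negative entries, chosen such that the graph
without the distinguished vertex is negative definite. -/
structure IsTorusDiagram (s t : ℕ) (A B : List ℤ) : Prop where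
  negA : ∀ k ∈ A, k < 0
  negB : ∀ k ∈ B, k < 0
  fracA : ∃ t' : ℕ, 0 < t' ∧ t' < t ∧ t ∣ s * t' + 1 ∧ contFrac A = -(t : ℚ) / (t' : ℚ)
  fracB : ∃ s' : ℕ, 0 < s' ∧ s' < s ∧ s ∣ t * s' + 1 ∧ contFrac B = -(s : ℚ) / (s' : ℚ)
  negDef : (torusGraph s t A B).HatNegDef

/-! ### The explicit series -/

/-- The sign `ε_m`. -/
def torusSign (s t m : ℤ) : ℤ :=
  if m ≡ s * t + s + t [ZMOD 2 * s * t] ∨ m ≡ s * t - s - t [ZMOD 2 * s * t] then -1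
  else if m ≡ s * t + s - t [ZMOD 2 * s * t] ∨ m ≡ s * t - s + t [ZMOD 2 * s * t] then 1
  else 0

/-- `ε_m (x^{m/2} - x^{-m/2}) q^{(m² - (st-s-t)²)/(4st)}`. -/
def torusTerm (s t : ℕ) (m : ℕ) : QSeries :=
  HahnSeries.single
    (((m : ℚ) ^ 2 - ((s : ℚ) * (t : ℚ) - (s : ℚ) - (t : ℚ)) ^ 2) / (4 * (s : ℚ) * (t : ℚ)))
    (LaurentPolynomial.C (torusSign s t m : ℚ) *
      (LaurentPolynomial.T (m : ℤ) - LaurentPolynomial.T (-(m : ℤ))))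

end

end PlumbedKnot

/-! Put `y = 2n + b` and `ℓ = M y`. A vertex of degree two contributes only when `ℓ` vanishes there.
The end of a leg carries `z - 1/z`, so `ℓ` equals `α` or `β` in `{1, -1}` there, with factor `-α` or
`-β`. The centre carries the principal value of `(z - 1/z)⁻¹`, so `j = ℓ center` is odd, with factor
`sgn(j)/2`. The leg equations are solved by transfer matrices whose entries are continuants. After a
change of sign the legs have continuants `t` and `s`, and `t'` and `s'` once the first entry is
removed, with `s t' + t s' + 1 = s t`. It follows that `m = ℓ knot` equals `-(s t j + s α + t β)`
(`TorusLegs.mulVec_knot`) and that `(y, M y) = -m²/(st) + const` (`TorusLegs.dotProduct_mulVec`).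

Coprimality gives `s + t < s t`. Hence `m` determines `j, α, β`, and `sgn m = -sgn j`, `ε_m = -αβ`:
the term is `½ sgn(m) ε_m x^{m/2} q^{m²/(4st) + κ}` (`TorusLegs.term_eq`). The matrix without `v₀`
is unimodular and `M` has a kernel vector with entry one at `v₀`, so for every `n` and every
representative the contributing vectors correspond bijectively to the `m` with `ε_m ≠ 0`
(`TorusLegs.isFormalSum_term`). Since `ε` is even, pairing `m` with `-m` gives the sum over `m ≥ 1`.

The same continuants settle the assumptions on the graph. Completing squares along the legs shows
that negative definiteness makes all suffix continuants positive; the continued fractions then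
determine the continuants, and the relation above gives unimodularity. Conversely it makes the
diagram built from expansions with entries at most `-2` negative definite. For the power of `q`, `M`
has exactly one null direction and is otherwise negative, and the weights enter through an identity
proved by blowing down the chain `A` reversed, `1`, `B` of determinant one to the empty chain
(`SuffixPos.sum_two_legs`). -/

namespace PlumbedKnot

/-! ### Continuants of negative continued fractions -/

/-- The matrix of one step of a negative continued fraction. -/
def stepMatrix (a : ℤ) : Matrix (Fin 2) (Fin 2) ℤ := !![a, -1; 1, 0]

/-- The matrix of a negative continued fraction `[a₁, …, a_r]`; its entries are, up to sign, the
continuants of the list and of the list with its first, last, or first and last entry removed. -/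
def chainMatrix (L : List ℤ) : Matrix (Fin 2) (Fin 2) ℤ := (L.map stepMatrix).prod

@[simp] lemma chainMatrix_nil : chainMatrix [] = 1 := rfl

lemma chainMatrix_cons (a : ℤ) (L : List ℤ) :
    chainMatrix (a :: L) = stepMatrix a * chainMatrix L := by
  simp [chainMatrix]

lemma chainMatrix_append (L L' : List ℤ) :
    chainMatrix (L ++ L') = chainMatrix L * chainMatrix L' := by
  simp [chainMatrix]

lemma chainMatrix_cons_zero (a : ℤ) (L : List ℤ) (j : Fin 2) :
    chainMatrix (a :: L) 0 j = a * chainMatrix L 0 j - chainMatrix L 1 j := by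
  simp [chainMatrix_cons, stepMatrix, Matrix.mul_apply, Fin.sum_univ_two, sub_eq_add_neg]

lemma chainMatrix_cons_one (a : ℤ) (L : List ℤ) (j : Fin 2) :
    chainMatrix (a :: L) 1 j = chainMatrix L 0 j := by
  simp [chainMatrix_cons, stepMatrix, Matrix.mul_apply, Fin.sum_univ_two]

lemma chainMatrix_det (L : List ℤ) :
    chainMatrix L 0 0 * chainMatrix L 1 1 - chainMatrix L 0 1 * chainMatrix L 1 0 = 1 := by
  induction L with
  | nil => simp
  | cons a L ih =>
    simp only [chainMatrix_cons_zero, chainMatrix_cons_one]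
    linear_combination ih

lemma chainMatrix_reverse (L : List ℤ) :
    chainMatrix L.reverse = !![chainMatrix L 0 0, -chainMatrix L 1 0;
      -chainMatrix L 0 1, chainMatrix L 1 1] := by
  induction L with
  | nil => ext i j; fin_cases i <;> fin_cases j <;> simp
  | cons a L ih =>
    rw [List.reverse_cons, chainMatrix_append, ih]
    ext i j
    fin_cases i <;> fin_cases j <;>
      simp [chainMatrix_cons, stepMatrix, Matrix.mul_apply, Fin.sum_univ_two] <;> ring

/-- All suffixes of the list have positive continuants. -/
def SuffixPos : List ℤ → Prop
  | [] => True
  | a :: L => 0 < chainMatrix (a :: L) 0 0 ∧ SuffixPos L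

lemma SuffixPos.pos {L : List ℤ} (h : SuffixPos L) : 0 < chainMatrix L 0 0 := by
  cases L with
  | nil => simp
  | cons a L => exact h.1

lemma SuffixPos.nonneg {L : List ℤ} (h : SuffixPos L) : 0 ≤ chainMatrix L 1 0 := by
  cases L with
  | nil => simp
  | cons a L => rw [chainMatrix_cons_one]; exact h.2.pos.le

lemma SuffixPos.of_append {X Y : List ℤ} (h : SuffixPos (X ++ Y)) : SuffixPos Y := by
  induction X with
  | nil => exact h
  | cons a X ih => exact ih h.2

lemma suffixPos_cons {a : ℤ} {L : List ℤ} :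
    SuffixPos (a :: L) ↔ 0 < chainMatrix (a :: L) 0 0 ∧ SuffixPos L := Iff.rfl

/-- Replacing a suffix by one with the same continuants preserves positivity. -/
lemma SuffixPos.append_congr {X Y Y' : List ℤ} (h : SuffixPos (X ++ Y)) (hY : SuffixPos Y')
    (hM : ∀ i, chainMatrix Y i 0 = chainMatrix Y' i 0) : SuffixPos (X ++ Y') := by
  induction X with
  | nil => exact hY
  | cons a X ih =>
    rw [List.cons_append, suffixPos_cons] at h ⊢
    refine ⟨?_, ih h.2⟩
    have := h.1
    rw [← List.cons_append, chainMatrix_append, Matrix.mul_apply] at this ⊢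
    simpa only [hM] using this

lemma SuffixPos.head_pos {a : ℤ} {L : List ℤ} (h : SuffixPos (a :: L)) : 0 < a := by
  have h1 := h.1
  rw [chainMatrix_cons_zero] at h1
  have h2 := h.2.nonneg
  exact pos_of_mul_pos_left (a := a) (by linarith : 0 < a * chainMatrix L 0 0) h.2.pos.le

lemma SuffixPos.mem_pos {a : ℤ} {L : List ℤ} (h : SuffixPos L) (ha : a ∈ L) : 0 < a := by
  obtain ⟨X, Y, rfl⟩ := List.append_of_mem ha
  exact h.of_append.head_pos

/-- Entries at least two make continuants strictly increase when an entry is prepended. -/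
lemma suffixPos_of_two_le {L : List ℤ} (h : ∀ a ∈ L, 2 ≤ a) :
    SuffixPos L ∧ chainMatrix L 1 0 + 1 ≤ chainMatrix L 0 0 := by
  induction L with
  | nil => simp [SuffixPos]
  | cons a L ih =>
    obtain ⟨h1, h2⟩ := ih fun b hb => h b (by simp [hb])
    have ha : 2 ≤ a := h a (by simp)
    have := h1.pos
    have key : chainMatrix (a :: L) 1 0 + 1 ≤ chainMatrix (a :: L) 0 0 := by
      rw [chainMatrix_cons_zero, chainMatrix_cons_one]; nlinarith
    refine ⟨⟨?_, h1⟩, key⟩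
    rw [chainMatrix_cons_one] at key
    linarith

/-- The sum of the entries of a positive definite linear chain of determinant one, which blows down
to the empty chain. -/
lemma SuffixPos.sum_sub_three {L : List ℤ} (h : SuffixPos L) (h1 : chainMatrix L 0 0 = 1) :
    (L.map fun a => a - 3).sum + chainMatrix L 1 0 - chainMatrix L 0 1 = 0 := by
  induction hn : L.length generalizing L with
  | zero =>
    obtain rfl := List.eq_nil_of_length_eq_zero hn
    simp
  | succ n ih =>
    -- If all entries were at least two, continuants would increase strictly and a nonempty chain
    -- would have determinant greater than one.
    have hmem : (1 : ℤ) ∈ L := by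
      by_contra hne
      have h2 : ∀ a ∈ L, 2 ≤ a := fun a ha => by
        have := h.mem_pos ha
        have : a ≠ 1 := fun e => hne (e ▸ ha)
        lia
      cases L with
      | nil => simp at hn
      | cons a L =>
        have h3 := (suffixPos_of_two_le h2).2
        have := h.2.pos
        rw [chainMatrix_cons_one] at h3
        lia
    obtain ⟨X, Y, rfl⟩ := List.append_of_mem hmem
    -- Blow down the entry `1`: it is deleted and its neighbours drop by one. In the interior this
    -- changes neither the matrix nor the sum of the `a - 3`. At an end the sum grows by one, while
    -- the continuant of the chain without that end drops by the determinant, which is one.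
    rcases X.eq_nil_or_concat' with rfl | ⟨X, a, rfl⟩
    · rcases Y with _ | ⟨b, Y⟩
      · simp [chainMatrix_cons_zero, chainMatrix_cons_one]
      · have hpos : SuffixPos ((b - 1) :: Y) := by
          refine ⟨?_, h.2.2⟩
          have := h.1
          simp only [chainMatrix_cons_zero, chainMatrix_cons_one] at this ⊢
          linarith
        simp only [List.nil_append, chainMatrix_cons_zero, chainMatrix_cons_one] at h1
        have := ih hpos (by simp only [chainMatrix_cons_zero]; linarith)
          (by simpa using hn)
        simp only [List.nil_append, chainMatrix_cons_zero, chainMatrix_cons_one, List.map_cons,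
          List.sum_cons] at this ⊢
        linarith
    · rcases Y with _ | ⟨b, Y⟩
      · rw [List.append_assoc, List.singleton_append] at h h1 ⊢
        have hs1 := h.of_append.1
        have hM : ∀ i, chainMatrix [a, 1] i 0 = chainMatrix [a - 1] i 0 := fun i => by
          fin_cases i <;> simp [chainMatrix_cons_zero, chainMatrix_cons_one]
        have hpos : SuffixPos (X ++ [a - 1]) :=
          h.append_congr ⟨by rwa [hM] at hs1, trivial⟩ hM
        have := ih hpos (by
          rw [chainMatrix_append, Matrix.mul_apply] at h1 ⊢
          simpa only [hM] using h1) (by simp at hn ⊢; omega)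
        simp only [List.map_append, List.map_cons, List.sum_append, List.sum_cons,
          List.map_nil, List.sum_nil, chainMatrix_append, Matrix.mul_apply, Fin.sum_univ_two,
          chainMatrix_cons_zero, chainMatrix_cons_one, chainMatrix_nil] at this h1 ⊢
        simp at this h1 ⊢
        linarith
      · have hM : chainMatrix (a :: 1 :: b :: Y) = chainMatrix ((a - 1) :: (b - 1) :: Y) := by
          simp only [chainMatrix_cons, ← mul_assoc]
          congr 1
          ext i j
          fin_cases i <;> fin_cases j <;>
            simp [stepMatrix, Matrix.mul_apply, Fin.sum_univ_two] <;> ring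
        rw [List.append_assoc] at h h1 ⊢
        simp only [List.cons_append, List.nil_append] at h h1 ⊢
        have hs := h.of_append
        have hs1 := hs.1
        have hs2 := hs.2.1
        rw [hM] at hs1
        have hpos : SuffixPos (X ++ (a - 1) :: (b - 1) :: Y) := by
          refine h.append_congr ⟨hs1, ?_, hs.2.2.2⟩ fun i => by rw [hM]
          simp only [chainMatrix_cons_zero, chainMatrix_cons_one] at hs2 ⊢
          linarith
        rw [chainMatrix_append, hM, ← chainMatrix_append] at h1 ⊢
        have := ih hpos h1 (by simp at hn ⊢; omega)
        simp only [List.map_append, List.map_cons, List.sum_append, List.sum_cons] at this ⊢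
        linarith

/-- Two positive definite chains joined into a chain of determinant one form a positive definite
chain. -/
lemma SuffixPos.reverse_append {A Y : List ℤ} (hA : SuffixPos A) (hY : SuffixPos Y)
    (h : chainMatrix A 0 0 * chainMatrix Y 0 0 - chainMatrix A 1 0 * chainMatrix Y 1 0 = 1) :
    SuffixPos (A.reverse ++ Y) := by
  induction A generalizing Y with
  | nil => simpa using hY
  | cons a A ih =>
    -- Moving `a` across the junction does not change the determinant of the joined chain. The new
    -- suffix continuant is positive because its product with a positive number is one plus
    -- something nonnegative.
    have h' : chainMatrix A 0 0 * chainMatrix (a :: Y) 0 0 -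
        chainMatrix A 1 0 * chainMatrix (a :: Y) 1 0 = 1 := by
      simp only [chainMatrix_cons_zero, chainMatrix_cons_one] at h ⊢
      linarith
    rw [List.reverse_cons, List.append_assoc, List.singleton_append]
    refine ih hA.2 ⟨?_, hY⟩ h'
    have h1 := hA.2.pos
    have h2 := mul_nonneg hA.2.nonneg hY.pos.le
    rw [chainMatrix_cons_one] at h'
    exact pos_of_mul_pos_right (by linarith : 0 < chainMatrix A 0 0 * chainMatrix (a :: Y) 0 0)
      h1.le

/-- The sum of the entries of two legs which, joined to a central vertex of weight one, form a
positive definite chain of determinant one. -/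
lemma SuffixPos.sum_two_legs {A B : List ℤ} (hA : SuffixPos A) (hB : SuffixPos B)
    (h : chainMatrix B 0 0 * chainMatrix A 1 0 + chainMatrix A 0 0 * chainMatrix B 1 0 + 1 =
      chainMatrix B 0 0 * chainMatrix A 0 0) :
    (((A.map fun a => a - 3).sum + (B.map fun a => a - 3).sum - 2 : ℤ) : ℚ) +
      (chainMatrix B 0 0 - chainMatrix A 0 1) / chainMatrix A 0 0 +
      (chainMatrix A 0 0 - chainMatrix B 0 1) / chainMatrix B 0 0 = 0 := by
  have hA0 := hA.pos
  have hB0 := hB.pos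
  have h1B : SuffixPos (1 :: B) := by
    refine ⟨?_, hB⟩
    rw [chainMatrix_cons_zero]
    have := mul_nonneg hB0.le hA.nonneg
    exact pos_of_mul_pos_right (a := chainMatrix A 0 0) (by linarith) hA0.le
  -- The chain is `A` read towards the centre, the centre `1`, then `B`; `h` says that its
  -- determinant is one.
  have hpos := hA.reverse_append h1B (by
    simp only [chainMatrix_cons_zero, chainMatrix_cons_one]; linarith)
  have hdA := chainMatrix_det A
  have hdB := chainMatrix_det B
  have h00 : chainMatrix (A.reverse ++ 1 :: B) 0 0 = 1 := by
    simp [chainMatrix_append, chainMatrix_reverse, Matrix.mul_apply, Fin.sum_univ_two,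
      chainMatrix_cons_zero, chainMatrix_cons_one]
    linarith
  have key := hpos.sum_sub_three h00
  simp [chainMatrix_append, chainMatrix_reverse, Matrix.mul_apply, Fin.sum_univ_two,
    chainMatrix_cons_zero, chainMatrix_cons_one]
    at key
  generalize chainMatrix A 0 0 = a at *
  generalize chainMatrix A 0 1 = a1 at *
  generalize chainMatrix A 1 0 = a2 at *
  generalize chainMatrix A 1 1 = a3 at *
  generalize chainMatrix B 0 0 = b at *
  generalize chainMatrix B 0 1 = b1 at *
  generalize chainMatrix B 1 0 = b2 at *
  generalize chainMatrix B 1 1 = b3 at *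
  have hsum : ((A.map fun a => a - 3).sum + (B.map fun a => a - 3).sum - 2) +
      (-(a1 * (b - b2)) + a3 * b) + (a * (b1 - b3) * (-1) + a2 * b1) = 0 := by
    linarith
  -- The continuants of the joined chain with one end removed are the two quotients of the
  -- statement, by the leg determinants and `h`.
  have hP : a * (-(a1 * (b - b2)) + a3 * b) = b - a1 := by
    linear_combination b * hdA + a1 * h
  have hQ : b * (a * (b1 - b3) * (-1) + a2 * b1) = a - b1 := by
    linear_combination a * hdB + b1 * h
  have hP' : (b - a1 : ℚ) / a = ((-(a1 * (b - b2)) + a3 * b : ℤ) : ℚ) := by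
    rw [div_eq_iff (by exact_mod_cast hA0.ne'), mul_comm]
    exact_mod_cast hP.symm
  have hQ' : (a - b1 : ℚ) / b = ((a * (b1 - b3) * (-1) + a2 * b1 : ℤ) : ℚ) := by
    rw [div_eq_iff (by exact_mod_cast hB0.ne'), mul_comm]
    exact_mod_cast hQ.symm
  rw [hP', hQ']
  exact_mod_cast hsum

/-! ### The linking matrix of the star -/

/-- The function on `ℕ` with value `c` at `0`, followed by the values of `f`, followed by zeros. -/
def legExt {Q : Type*} [Zero Q] {p : ℕ} (c : Q) (f : Fin p → Q) : ℕ → Q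
  | 0 => c
  | i + 1 => if h : i < p then f ⟨i, h⟩ else 0

section LegExt

variable {Q : Type*} {p : ℕ}

@[simp] lemma legExt_zero [Zero Q] (c : Q) (f : Fin p → Q) : legExt c f 0 = c := rfl

@[simp] lemma legExt_val_succ [Zero Q] (c : Q) (f : Fin p → Q) (i : Fin p) :
    legExt c f (i.val + 1) = f i := by
  simp [legExt]

@[simp] lemma legExt_last [Zero Q] (c : Q) (f : Fin p → Q) : legExt c f (p + 1) = 0 := by
  simp [legExt]

lemma sum_ite_val_eq [AddCommMonoid Q] (c : Q) (f : Fin p → Q) (n : ℕ) :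
    ∑ i : Fin p, (if i.val = n then f i else 0) = legExt c f (n + 1) := by
  simp only [legExt]
  split_ifs with h
  · rw [Finset.sum_eq_single ⟨n, h⟩]
    · simp
    · intro i _ hi
      rw [if_neg]
      rintro rfl
      exact hi rfl
    · simp
  · exact Finset.sum_eq_zero fun i _ => if_neg fun hi => h (by have := i.2; omega)

/-- Position `0` stands for the centre and position `p + 1` for a fictitious vertex with value zero,
so every leg vertex, first and last included, has the same two-neighbour formula. -/
lemma sum_leg_neighbors [AddCommMonoid Q] (c : Q) (f : Fin p → Q) (i : Fin p) :
    (if i.val = 0 then c else 0) +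
      ∑ i' : Fin p, (if i.val + 1 = i'.val ∨ i'.val + 1 = i.val then f i' else 0) =
      legExt c f i.val + legExt c f (i.val + 2) := by
  have h1 : ∀ i' : Fin p, (if i.val + 1 = i'.val ∨ i'.val + 1 = i.val then f i' else 0) =
      (if i'.val = i.val + 1 then f i' else 0) + (if i'.val + 1 = i.val then f i' else 0) := by
    intro i'
    split_ifs <;> first | omega | simp
  rw [Finset.sum_congr rfl fun i' _ => h1 i', Finset.sum_add_distrib, sum_ite_val_eq c]
  obtain ⟨_ | n, hn⟩ := i
  · simp
  · simp only [Nat.add_right_cancel_iff, sum_ite_val_eq c]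
    simp [add_comm _ (legExt c f (n + 1))]

end LegExt

namespace StarVert

variable {p r : ℕ}

@[simp] lemma edge_center_knot : Edge (center : StarVert p r) knot := .knot

@[simp] lemma edge_center_legA {i : Fin p} :
    Edge (center : StarVert p r) (legA i) ↔ i.val = 0 :=
  ⟨fun h => by cases h; assumption, .startA i⟩

@[simp] lemma edge_center_legB {j : Fin r} :
    Edge (center : StarVert p r) (legB j) ↔ j.val = 0 :=
  ⟨fun h => by cases h; assumption, .startB j⟩

@[simp] lemma edge_legA_legA {i i' : Fin p} :
    Edge (legA i : StarVert p r) (legA i') ↔ i.val + 1 = i'.val :=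
  ⟨fun h => by cases h; assumption, .stepA i i'⟩

@[simp] lemma edge_legB_legB {j j' : Fin r} :
    Edge (legB j : StarVert p r) (legB j') ↔ j.val + 1 = j'.val :=
  ⟨fun h => by cases h; assumption, .stepB j j'⟩

@[simp] lemma not_edge_center (v : StarVert p r) : ¬Edge v center := by rintro ⟨⟩
@[simp] lemma not_edge_knot (v : StarVert p r) : ¬Edge knot v := by rintro ⟨⟩
@[simp] lemma not_edge_legA_knot (i : Fin p) : ¬Edge (legA i : StarVert p r) knot := by rintro ⟨⟩
@[simp] lemma not_edge_legB_knot (j : Fin r) : ¬Edge (legB j : StarVert p r) knot := by rintro ⟨⟩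
@[simp] lemma not_edge_legA_legB (i : Fin p) (j : Fin r) : ¬Edge (legA i) (legB j) := by
  rintro ⟨⟩
@[simp] lemma not_edge_legB_legA (i : Fin p) (j : Fin r) : ¬Edge (legB j) (legA i) := by
  rintro ⟨⟩

end StarVert

open StarVert

namespace Graph

variable {V : Type} [Fintype V]

open Classical in
/-- The sum of a function over the neighbours of a vertex. -/
noncomputable def nbrSum {Q : Type*} [AddCommMonoid Q] (Γ : Graph V) (y : V → Q) (v : V) : Q :=
  ∑ u, if Γ.graph.Adj v u then y u else 0

lemma deg_eq_nbrSum (Γ : Graph V) (v : V) : Γ.deg v = Γ.nbrSum (fun _ => (1 : ℕ)) v := by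
  classical
  simp [deg, nbrSum, ← SimpleGraph.card_neighborFinset_eq_degree,
    SimpleGraph.neighborFinset_eq_filter]

lemma sum_M_smul {Q : Type*} [AddCommGroup Q] (Γ : Graph V) (y : V → Q) (v : V) :
    ∑ u, Γ.M v u • y u = Γ.weight v • y v + Γ.nbrSum y v := by
  classical
  have h : ∀ u, Γ.M v u • y u = (if v = u then Γ.weight v • y v else 0) +
      if Γ.graph.Adj v u then y u else 0 := by
    intro u
    by_cases huv : v = u
    · subst huv; simp [M]
    · by_cases ha : Γ.graph.Adj v u <;> simp [M, huv, ha]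
  rw [Finset.sum_congr rfl fun u _ => h u, Finset.sum_add_distrib, nbrSum]
  simp

lemma M_isSymm {W : Type} (Γ : Graph W) : Γ.M.IsSymm := by
  classical
  ext u v
  simp only [M, Matrix.transpose_apply, Matrix.of_apply, Γ.graph.adj_comm v u]
  by_cases h : u = v
  · subst h; simp
  · simp [h, Ne.symm h]

end Graph

section Star

variable {s t : ℕ} {A B : List ℤ}

/-- The values of a function along the first leg of the star, starting at the centre. -/
def valA {p r : ℕ} {Q : Type*} [Zero Q] (y : StarVert p r → Q) : ℕ → Q :=
  legExt (y center) fun i => y (legA i)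

/-- The values of a function along the second leg of the star, starting at the centre. -/
def valB {p r : ℕ} {Q : Type*} [Zero Q] (y : StarVert p r → Q) : ℕ → Q :=
  legExt (y center) fun j => y (legB j)

variable {Q : Type*} [AddCommMonoid Q] (y : StarVert A.length B.length → Q)

lemma nbrSum_center : (torusGraph s t A B).nbrSum y center = y knot + (valA y 1 + valB y 1) := by
  simp [Graph.nbrSum, torusGraph, Fintype.sum_sum_type, valA, valB,
    sum_ite_val_eq (y center) (fun i => y (legA i)) 0,
    sum_ite_val_eq (y center) (fun i => y (legB i)) 0]

lemma nbrSum_knot : (torusGraph s t A B).nbrSum y knot = y center := by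
  simp [Graph.nbrSum, torusGraph, Fintype.sum_sum_type]

lemma nbrSum_legA (i : Fin A.length) :
    (torusGraph s t A B).nbrSum y (legA i) = valA y i.val + valA y (i.val + 2) := by
  rw [valA, ← sum_leg_neighbors]
  simp only [Graph.nbrSum, torusGraph, Fintype.sum_sum_type, SimpleGraph.fromRel_adj]
  congr 1
  · simp
  · simp
    refine Finset.sum_congr rfl fun i' _ => if_congr ⟨fun h => h.2, fun h => ⟨?_, h⟩⟩ rfl rfl
    rintro rfl
    omega

lemma nbrSum_legB (i : Fin B.length) :
    (torusGraph s t A B).nbrSum y (legB i) = valB y i.val + valB y (i.val + 2) := by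
  rw [valB, ← sum_leg_neighbors]
  simp only [Graph.nbrSum, torusGraph, Fintype.sum_sum_type, SimpleGraph.fromRel_adj]
  congr 1
  · simp
  · simp
    refine Finset.sum_congr rfl fun i' _ => if_congr ⟨fun h => h.2, fun h => ⟨?_, h⟩⟩ rfl rfl
    rintro rfl
    omega

@[simp] lemma torusGraph_root : (torusGraph s t A B).root = knot := rfl

lemma deg_center (hA : A ≠ []) (hB : B ≠ []) : (torusGraph s t A B).deg center = 3 := by
  have := List.length_pos_iff.2 hA
  have := List.length_pos_iff.2 hB
  rw [Graph.deg_eq_nbrSum, nbrSum_center]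
  simp [valA, valB, legExt, *]

lemma deg_knot : (torusGraph s t A B).deg knot = 1 := by
  rw [Graph.deg_eq_nbrSum, nbrSum_knot]

lemma deg_legA (i : Fin A.length) :
    (torusGraph s t A B).deg (legA i) = if i.val + 1 = A.length then 1 else 2 := by
  rw [Graph.deg_eq_nbrSum, nbrSum_legA]
  obtain ⟨_ | i, hi⟩ := i
  · simp [valA, legExt]; split_ifs <;> omega
  · simp [valA, legExt]; split_ifs <;> omega

lemma deg_legB (i : Fin B.length) :
    (torusGraph s t A B).deg (legB i) = if i.val + 1 = B.length then 1 else 2 := by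
  rw [Graph.deg_eq_nbrSum, nbrSum_legB]
  obtain ⟨_ | i, hi⟩ := i
  · simp [valB, legExt]; split_ifs <;> omega
  · simp [valB, legExt]; split_ifs <;> omega

lemma torusGraph_connected : (torusGraph s t A B).graph.Connected := by
  have hA : ∀ n (h : n < A.length), (torusGraph s t A B).graph.Reachable center (legA ⟨n, h⟩) := by
    intro n
    induction n with
    | zero => exact fun h => SimpleGraph.Adj.reachable (by simp [torusGraph])
    | succ n ih =>
      exact fun h => (ih (by omega)).trans (SimpleGraph.Adj.reachable (by simp [torusGraph]))
  have hB : ∀ n (h : n < B.length), (torusGraph s t A B).graph.Reachable center (legB ⟨n, h⟩) := by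
    intro n
    induction n with
    | zero => exact fun h => SimpleGraph.Adj.reachable (by simp [torusGraph])
    | succ n ih =>
      exact fun h => (ih (by omega)).trans (SimpleGraph.Adj.reachable (by simp [torusGraph]))
  have key : ∀ v, (torusGraph s t A B).graph.Reachable center v := by
    rintro ((_ | _) | (i | j))
    · exact .refl _
    · exact SimpleGraph.Adj.reachable ⟨by simp, .inl .knot⟩
    · exact hA _ i.2
    · exact hB _ j.2
  exact ⟨fun u v => (key u).symm.trans (key v)⟩

/-- A connected graph with one edge fewer than vertices is a tree; the edges are counted by summing
degrees. -/
lemma torusGraph_isTree (hA : A ≠ []) (hB : B ≠ []) : (torusGraph s t A B).graph.IsTree := by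
  classical
  rw [SimpleGraph.isTree_iff_connected_and_card]
  refine ⟨torusGraph_connected, ?_⟩
  have hleg : ∀ p : ℕ, 0 < p → ∑ i : Fin p, (if i.val + 1 = p then 1 else 2) + 1 = 2 * p := by
    intro p hp
    obtain ⟨p, rfl⟩ := Nat.exists_eq_succ_of_ne_zero hp.ne'
    rw [Fin.sum_univ_castSucc]
    have : ∀ i : Fin p, (if (i.castSucc : Fin (p+1)).val + 1 = p.succ then 1 else 2) = 2 := by
      intro i; rw [if_neg]; have := i.2; simp; omega
    rw [Finset.sum_congr rfl fun i _ => this i]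
    simp; ring
  have hs := (torusGraph s t A B).graph.sum_degrees_eq_twice_card_edges
  have hd : ∀ v, (torusGraph s t A B).graph.degree v = (torusGraph s t A B).deg v := fun v => by
    unfold Graph.deg; congr!
  simp only [hd, Fintype.sum_sum_type, deg_legA, deg_legB] at hs
  have h1 := hleg _ (List.length_pos_iff.2 hA)
  have h2 := hleg _ (List.length_pos_iff.2 hB)
  simp [deg_center hA hB, deg_knot] at hs
  rw [Nat.card_eq_fintype_card, ← SimpleGraph.edgeFinset_card]
  simp
  omega

end Star

/-! ### Linear algebra over the integers -/

/-- An integer matrix is unimodular if it acts injectively with coefficients in every abelian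
group. -/
lemma isUnit_det_of_injective {n : Type} [Fintype n] [DecidableEq n] (N : Matrix n n ℤ)
    (h : ∀ (Q : Type) [AddCommGroup Q] (y : n → Q), (∀ v, ∑ u, N v u • y u = 0) → y = 0) :
    IsUnit N.det := by
  let R : Submodule ℤ (n → ℤ) := LinearMap.range N.transpose.mulVecLin
  -- In the cokernel of the transpose the classes of the basis vectors solve the homogeneous system.
  -- Their vanishing means that the transpose is surjective.
  have h0 := h ((n → ℤ) ⧸ R) (fun u => R.mkQ (Pi.single u 1)) (by
    intro v
    rw [← Finset.sum_congr rfl fun u _ => R.mkQ.map_smul (N v u) (Pi.single u 1), ← map_sum,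
      Submodule.mkQ_apply, Submodule.Quotient.mk_eq_zero]
    refine ⟨Pi.single v 1, ?_⟩
    ext u
    simp [Finset.sum_apply, Pi.single_apply])
  have htop : R = ⊤ := by
    rw [eq_top_iff, ← (Pi.basisFun ℤ n).span_eq, Submodule.span_le]
    rintro _ ⟨u, rfl⟩
    have := congrFun h0 u
    simpa using this
  have hsurj : Function.Surjective N.transpose.mulVec := LinearMap.range_eq_top.1 htop
  have := Matrix.mulVec_surjective_iff_isUnit.1 hsurj
  rwa [Matrix.isUnit_iff_isUnit_det, Matrix.det_transpose] at this

/-- The chain matrix is the transfer matrix of the three-term recursion, taking the last pair of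
values to the first. -/
lemma leg_recursion {Q : Type*} [AddCommGroup Q] (L : List ℤ) (f : ℕ → Q)
    (h : ∀ i (hi : i < L.length), f i + f (i + 2) = L[i] • f (i + 1)) :
    f 0 = chainMatrix L 0 0 • f L.length + chainMatrix L 0 1 • f (L.length + 1) ∧
      f 1 = chainMatrix L 1 0 • f L.length + chainMatrix L 1 1 • f (L.length + 1) := by
  induction L generalizing f with
  | nil => simp
  | cons a L ih =>
    obtain ⟨h0, h1⟩ := ih (fun i => f (i + 1)) fun i hi =>
      h (i + 1) (by simpa using hi)
    have h2 := h 0 (by simp)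
    simp only [chainMatrix_cons_zero, chainMatrix_cons_one, List.length_cons]
    simp only [zero_add, List.getElem_cons_zero] at h0 h1 h2
    refine ⟨?_, h0⟩
    rw [eq_sub_of_add_eq h2, h0, h1]
    module

lemma leg_eq_zero {Q : Type*} [AddCommGroup Q] (L : List ℤ) (f : ℕ → Q)
    (h : ∀ i (hi : i < L.length), f i + f (i + 2) = L[i] • f (i + 1))
    (h0 : f L.length = 0) (h1 : f (L.length + 1) = 0) (i : ℕ) (hi : i ≤ L.length) : f i = 0 := by
  induction L generalizing f i with
  | nil => simpa [Nat.le_zero.1 hi] using h0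
  | cons a L ih =>
    cases i with
    | zero => rw [(leg_recursion (a :: L) f h).1, h0, h1, smul_zero, smul_zero, add_zero]
    | succ i =>
      exact ih (fun i => f (i + 1)) (fun i hi => h (i + 1) (by simpa using hi))
        (by simpa using h0) (by simpa using h1) i (by simpa using hi)

/-- The values at the start of a leg, when the leg equations hold except for an inhomogeneity at
the last vertex. -/
lemma leg_solve {Q : Type*} [AddCommGroup Q] (L : List ℤ) (hL : L ≠ []) (f : ℕ → Q) (α : Q)
    (hf : f (L.length + 1) = 0)
    (h : ∀ i (hi : i < L.length),
      f i + f (i + 2) = L[i] • f (i + 1) + if i + 1 = L.length then α else 0) :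
    f 0 = chainMatrix L 0 0 • f L.length - chainMatrix L 0 1 • α ∧
      f 1 = chainMatrix L 1 0 • f L.length - chainMatrix L 1 1 • α := by
  have hp := List.length_pos_iff.2 hL
  -- The inhomogeneity at the last vertex is absorbed into a fictitious next value `-α`, which makes
  -- the recursion homogeneous.
  have := leg_recursion L (Function.update f (L.length + 1) (-α)) (by
    intro i hi
    have := h i hi
    rw [Function.update_of_ne (a := i) (by omega), Function.update_of_ne (a := i + 1) (by omega)]
    by_cases hi' : i + 1 = L.length
    · rw [if_pos hi', show i + 2 = L.length + 1 by omega, hf, add_zero] at this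
      rw [show i + 2 = L.length + 1 by omega, Function.update_self, this]
      abel
    · rw [if_neg hi', add_zero] at this
      rw [Function.update_of_ne (by omega), this])
  rw [Function.update_of_ne (by omega), Function.update_of_ne (by omega), Function.update_self,
    Function.update_of_ne (by omega)] at this
  simpa [sub_eq_add_neg] using this

/-! ### Unimodularity of torus knot diagrams -/

/-- The properties of the legs of a diagram of the torus knot `T(s,t)`: they are positive definite
chains (up to sign) of determinants `t` and `s`, and the chain obtained by joining them to a central
vertex of weight one has determinant one. -/
structure TorusLegs (s t : ℕ) (A B : List ℤ) : Prop where
  posA : SuffixPos (A.map Neg.neg)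
  posB : SuffixPos (B.map Neg.neg)
  detA : chainMatrix (A.map Neg.neg) 0 0 = t
  detB : chainMatrix (B.map Neg.neg) 0 0 = s
  det_chain : s * chainMatrix (A.map Neg.neg) 1 0 + t * chainMatrix (B.map Neg.neg) 1 0 + 1 = s * t
  neA : A ≠ []
  neB : B ≠ []

section

variable {s t : ℕ} {A B : List ℤ} {Q : Type*} [AddCommGroup Q]

lemma sum_M_center (y : StarVert A.length B.length → Q) :
    ∑ u, (torusGraph s t A B).M center u • y u = -y center + (y knot + (valA y 1 + valB y 1)) := by
  rw [Graph.sum_M_smul, nbrSum_center]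
  simp [torusGraph]

lemma sum_M_knot (y : StarVert A.length B.length → Q) :
    ∑ u, (torusGraph s t A B).M knot u • y u = -((s * t : ℤ) • y knot) + y center := by
  rw [Graph.sum_M_smul, nbrSum_knot]
  simp [torusGraph]

lemma sum_M_legA (y : StarVert A.length B.length → Q) (i : Fin A.length) :
    ∑ u, (torusGraph s t A B).M (legA i) u • y u =
      A[i] • valA y (i.val + 1) + (valA y i.val + valA y (i.val + 2)) := by
  rw [Graph.sum_M_smul, nbrSum_legA]
  simp [torusGraph, valA]

lemma sum_M_legB (y : StarVert A.length B.length → Q) (i : Fin B.length) :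
    ∑ u, (torusGraph s t A B).M (legB i) u • y u =
      B[i] • valB y (i.val + 1) + (valB y i.val + valB y (i.val + 2)) := by
  rw [Graph.sum_M_smul, nbrSum_legB]
  simp [torusGraph, valB]

lemma legA_solve (hA : A ≠ []) (y : StarVert A.length B.length → Q) (α : Q)
    (h : ∀ i, ∑ u, (torusGraph s t A B).M (legA i) u • y u =
      if i.val + 1 = A.length then α else 0) :
    y center = chainMatrix (A.map Neg.neg) 0 0 • valA y A.length -
      chainMatrix (A.map Neg.neg) 0 1 • α ∧
    valA y 1 = chainMatrix (A.map Neg.neg) 1 0 • valA y A.length -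
      chainMatrix (A.map Neg.neg) 1 1 • α := by
  have := leg_solve (A.map Neg.neg) (by simpa using hA) (valA y) α (by simp [valA]) (by
    intro i hi
    have hi' : i < A.length := by simpa using hi
    have := h ⟨i, hi'⟩
    rw [sum_M_legA] at this
    simp only [List.length_map, List.getElem_map, neg_smul] at this ⊢
    rw [← this]
    simp)
  simpa [valA] using this

lemma legB_solve (hB : B ≠ []) (y : StarVert A.length B.length → Q) (β : Q)
    (h : ∀ i, ∑ u, (torusGraph s t A B).M (legB i) u • y u =
      if i.val + 1 = B.length then β else 0) :
    y center = chainMatrix (B.map Neg.neg) 0 0 • valB y B.length -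
      chainMatrix (B.map Neg.neg) 0 1 • β ∧
    valB y 1 = chainMatrix (B.map Neg.neg) 1 0 • valB y B.length -
      chainMatrix (B.map Neg.neg) 1 1 • β := by
  have := leg_solve (B.map Neg.neg) (by simpa using hB) (valB y) β (by simp [valB]) (by
    intro i hi
    have hi' : i < B.length := by simpa using hi
    have := h ⟨i, hi'⟩
    rw [sum_M_legB] at this
    simp only [List.length_map, List.getElem_map, neg_smul] at this ⊢
    rw [← this]
    simp)
  simpa [valB] using this

/-- The linking matrix without the distinguished vertex acts injectively with arbitrary
coefficients. -/
lemma TorusLegs.eq_zero (h : TorusLegs s t A B) (y : StarVert A.length B.length → Q)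
    (hk : y knot = 0)
    (hy : ∀ v, v ≠ knot → ∑ u, (torusGraph s t A B).M v u • y u = 0) : y = 0 := by
  obtain ⟨hA0, hA1⟩ := legA_solve h.neA y 0 fun i => by rw [hy _ (by simp)]; simp
  obtain ⟨hB0, hB1⟩ := legB_solve h.neB y 0 fun i => by rw [hy _ (by simp)]; simp
  have hc := hy center (by simp)
  rw [sum_M_center, hk, hA1, hB1] at hc
  simp only [smul_zero, sub_zero, zero_add, h.detA, h.detB] at hA0 hB0 hc
  set X := valA y A.length
  set Y := valB y B.length
  set a := chainMatrix (A.map Neg.neg) 1 0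
  set b := chainMatrix (B.map Neg.neg) 1 0
  have hXY : (t : ℤ) • X = (s : ℤ) • Y := hA0.symm.trans hB0
  have hrel := h.det_chain
  have e : (t : ℤ) • X = a • X + b • Y := hA0.symm.trans (neg_add_eq_zero.1 hc)
  -- Coefficients may have torsion, so nothing is divided by `s` or `t`. Instead `s * t - s * a - t
  -- * b = 1` writes `X` itself as a combination of the equations.
  have hX : X = 0 := by
    calc X = (s * t - s * a - t * b : ℤ) • X := by
            rw [show (s * t - s * a - t * b : ℤ) = 1 by linarith, one_smul]
      _ = (s : ℤ) • ((t : ℤ) • X - a • X) - b • ((t : ℤ) • X) := by module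
      _ = 0 := by rw [sub_eq_of_eq_add' e, hXY]; module
  have hY : Y = 0 := by
    calc Y = (s * t - s * a - t * b : ℤ) • Y := by
            rw [show (s * t - s * a - t * b : ℤ) = 1 by linarith, one_smul]
      _ = (t : ℤ) • ((s : ℤ) • Y - b • Y) - a • ((s : ℤ) • Y) := by module
      _ = 0 := by
        have e' : (s : ℤ) • Y - b • Y = a • X := sub_eq_of_eq_add (hXY ▸ e)
        rw [e', ← hXY]; module
  have hc0 : y center = 0 := by rw [hA0, hX, smul_zero]
  funext v
  rcases v with (_ | _) | (i | j)
  · exact hc0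
  · exact hk
  · have := leg_eq_zero (A.map Neg.neg) (valA y) (by
      intro i hi
      have hi' : i < A.length := by simpa using hi
      have := hy (legA ⟨i, hi'⟩) (by simp)
      rw [sum_M_legA] at this
      simp only [List.getElem_map, neg_smul]
      rw [eq_neg_iff_add_eq_zero, add_comm]
      exact this) (by simpa using hX) (by simp [valA]) (i.val + 1) (by simp)
    simpa [valA] using this
  · have := leg_eq_zero (B.map Neg.neg) (valB y) (by
      intro i hi
      have hi' : i < B.length := by simpa using hi
      have := hy (legB ⟨i, hi'⟩) (by simp)
      rw [sum_M_legB] at this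
      simp only [List.getElem_map, neg_smul]
      rw [eq_neg_iff_add_eq_zero, add_comm]
      exact this) (by simpa using hY) (by simp [valB]) (j.val + 1) (by simp)
    simpa [valB] using this

end

namespace Graph

variable {V : Type} [Fintype V]

open Classical in
/-- Extension by zero at the distinguished vertex. -/
noncomputable def extend {Q : Type*} {W : Type} [Zero Q] (Γ : Graph W)
    (y : {v : W // v ≠ Γ.root} → Q) (v : W) : Q :=
  if h : v ≠ Γ.root then y ⟨v, h⟩ else 0

@[simp] lemma extend_root {Q : Type*} {W : Type} [Zero Q] (Γ : Graph W)
    (y : {v : W // v ≠ Γ.root} → Q) :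
    Γ.extend y Γ.root = 0 := by simp [extend]

@[simp] lemma extend_coe {Q : Type*} {W : Type} [Zero Q] (Γ : Graph W)
    (y : {v : W // v ≠ Γ.root} → Q) (v : {v : W // v ≠ Γ.root}) : Γ.extend y v = y v := by
  simp [extend, v.2]

lemma sum_Mhat_smul {Q : Type*} [AddCommGroup Q] (Γ : Graph V)
    [Fintype {v : V // v ≠ Γ.root}] (y : {v : V // v ≠ Γ.root} → Q)
    (v : {v : V // v ≠ Γ.root}) : ∑ u, Γ.Mhat v u • y u = ∑ u, Γ.M v u • Γ.extend y u := by
  classical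
  have : ∑ u, Γ.M v u • Γ.extend y u = ∑ u with u ≠ Γ.root, Γ.M v u • Γ.extend y u := by
    refine (Finset.sum_filter_of_ne fun u _ hu => ?_).symm
    rintro rfl
    simp at hu
  rw [this, Finset.sum_subtype (p := fun u => u ≠ Γ.root) _ (by simp)]
  exact Finset.sum_congr rfl fun u _ => by simp [Mhat]

lemma exists_mulVec_eq (Γ : Graph V) [Fintype {v : V // v ≠ Γ.root}]
    [DecidableEq {v : V // v ≠ Γ.root}] (h : IsUnit Γ.Mhat.det) (l : V → ℤ) :
    ∃ y : V → ℤ, y Γ.root = 0 ∧ ∀ v, v ≠ Γ.root → Γ.M.mulVec y v = l v := by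
  obtain ⟨y, hy⟩ := Matrix.mulVec_surjective_iff_isUnit.2
    ((Matrix.isUnit_iff_isUnit_det _).2 h) fun v => l v
  refine ⟨Γ.extend y, by simp, fun v hv => ?_⟩
  have := congrFun hy ⟨v, hv⟩
  have h2 := Γ.sum_Mhat_smul y ⟨v, hv⟩
  simp only [smul_eq_mul] at h2
  rw [← this]
  exact h2.symm

end Graph

section

variable {s t : ℕ} {A B : List ℤ}

lemma TorusLegs.isUnit_det (h : TorusLegs s t A B)
    [Fintype {v // v ≠ (torusGraph s t A B).root}]
    [DecidableEq {v // v ≠ (torusGraph s t A B).root}] : IsUnit (torusGraph s t A B).Mhat.det := by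
  refine isUnit_det_of_injective _ fun Q _ y hy => ?_
  have h0 := h.eq_zero ((torusGraph s t A B).extend y) (Graph.extend_root _ y) fun v hv => by
    rw [← hy ⟨v, hv⟩, Graph.sum_Mhat_smul]
  funext v
  rw [← Graph.extend_coe (torusGraph s t A B) y v, h0]
  rfl

lemma TorusLegs.exists_mulVec_eq (h : TorusLegs s t A B) (l : StarVert A.length B.length → ℤ) :
    ∃ y : StarVert A.length B.length → ℤ, y knot = 0 ∧
      ∀ v, v ≠ knot → (torusGraph s t A B).M.mulVec y v = l v := by
  classical
  exact Graph.exists_mulVec_eq _ h.isUnit_det l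

/-- The integer vector `l` is supported away from the inner vertices of the legs, with values
`α` and `β` at the ends of the legs. -/
structure EndSupported (l : StarVert A.length B.length → ℤ) (α β : ℤ) : Prop where
  legA : ∀ i : Fin A.length, l (legA i) = if i.val + 1 = A.length then α else 0
  legB : ∀ i : Fin B.length, l (legB i) = if i.val + 1 = B.length then β else 0

/-- Eliminating the leg variables leaves the equations at the centre and at `v₀`. Because of
`det_chain` and the weight `-st`, the values of `y` cancel from their combination: this is the
degeneracy of `M`. -/
lemma TorusLegs.mulVec_knot (h : TorusLegs s t A B) {y : StarVert A.length B.length → ℤ} {α β : ℤ}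
    (hl : EndSupported ((torusGraph s t A B).M.mulVec y) α β) :
    (torusGraph s t A B).M.mulVec y knot =
      -(s * t * (torusGraph s t A B).M.mulVec y center + s * α + t * β) := by
  obtain ⟨hA0, hA1⟩ := legA_solve h.neA y α hl.legA
  obtain ⟨hB0, hB1⟩ := legB_solve h.neB y β hl.legB
  have hc : (torusGraph s t A B).M.mulVec y center = _ := sum_M_center y
  have hk : (torusGraph s t A B).M.mulVec y knot = _ := sum_M_knot y
  have hdA := chainMatrix_det (A.map Neg.neg)
  have hdB := chainMatrix_det (B.map Neg.neg)
  have hrel := h.det_chain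
  rw [hc, hk, hA1, hB1]
  simp only [h.detA, h.detB, smul_eq_mul] at hA0 hB0 hdA hdB ⊢
  generalize valA y A.length = X at *
  generalize valB y B.length = Y at *
  generalize y center = c at *
  generalize chainMatrix (A.map Neg.neg) 0 1 = a1 at *
  generalize chainMatrix (A.map Neg.neg) 1 0 = a2 at *
  generalize chainMatrix (A.map Neg.neg) 1 1 = a3 at *
  generalize chainMatrix (B.map Neg.neg) 0 1 = b1 at *
  generalize chainMatrix (B.map Neg.neg) 1 0 = b2 at *
  generalize chainMatrix (B.map Neg.neg) 1 1 = b3 at *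
  linear_combination c * hrel - (s * a2) * hA0 - (t * b2) * hB0 - s * α * hdA - t * β * hdB

lemma sum_mul_ite_last {L : List ℤ} (c : ℤ) (f : Fin L.length → ℤ) (hL : L ≠ []) (α : ℤ) :
    ∑ i, f i * (if i.val + 1 = L.length then α else 0) = legExt c f L.length * α := by
  obtain ⟨n, hn⟩ := Nat.exists_eq_succ_of_ne_zero (List.length_pos_iff.2 hL).ne'
  rw [← sum_ite_val_eq c f n |>.trans (congrArg _ hn.symm), Finset.sum_mul]
  refine Finset.sum_congr rfl fun i _ => ?_
  have : i.val + 1 = L.length ↔ i.val = n := by omega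
  simp [this]

/-- Only the centre, `v₀` and the leg ends enter the pairing. The end values of `y` are expressed
through `y center` by the leg equations, and `α² = β² = 1` makes the remainder independent of the
signs. -/
lemma TorusLegs.dotProduct_mulVec (h : TorusLegs s t A B) (hs : s ≠ 0) (ht : t ≠ 0)
    {y : StarVert A.length B.length → ℤ} {α β : ℤ} (hα : α ^ 2 = 1) (hβ : β ^ 2 = 1)
    (hl : EndSupported ((torusGraph s t A B).M.mulVec y) α β) :
    ((y ⬝ᵥ (torusGraph s t A B).M.mulVec y : ℤ) : ℚ) =
      -(((torusGraph s t A B).M.mulVec y knot : ℤ) : ℚ) ^ 2 / (s * t) +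
        (chainMatrix (A.map Neg.neg) 0 1 : ℚ) / t + (chainMatrix (B.map Neg.neg) 0 1 : ℚ) / s := by
  obtain ⟨hA0, hA1⟩ := legA_solve h.neA y α hl.legA
  obtain ⟨hB0, hB1⟩ := legB_solve h.neB y β hl.legB
  have hknot := h.mulVec_knot hl
  have hk : (torusGraph s t A B).M.mulVec y knot = _ := sum_M_knot y
  have key : y ⬝ᵥ (torusGraph s t A B).M.mulVec y =
      y center * (torusGraph s t A B).M.mulVec y center +
      y knot * (torusGraph s t A B).M.mulVec y knot +
      (valA y A.length * α + valB y B.length * β) := by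
    have hA := sum_mul_ite_last (y center) (fun i => y (legA i)) h.neA α
    have hB := sum_mul_ite_last (y center) (fun i => y (legB i)) h.neB β
    simp only [dotProduct, Fintype.sum_sum_type, hl.legA, hl.legB, hA, hB, valA, valB]
    simp
  rw [key]
  generalize (torusGraph s t A B).M.mulVec y center = j at *
  rw [h.detA] at hA0
  rw [h.detB] at hB0
  simp only [smul_eq_mul] at hA0 hB0 hk
  generalize (torusGraph s t A B).M.mulVec y knot = m at *
  generalize valA y A.length = X at *
  generalize valB y B.length = Y at *
  generalize y center = c at *
  generalize y knot = k at *
  have hs' : (s : ℚ) ≠ 0 := by exact_mod_cast hs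
  have ht' : (t : ℚ) ≠ 0 := by exact_mod_cast ht
  generalize chainMatrix (A.map Neg.neg) 0 1 = a1 at *
  generalize chainMatrix (B.map Neg.neg) 0 1 = b1 at *
  have key2 : s * t * (c * j + k * m + (X * α + Y * β)) = -m ^ 2 + s * a1 + t * b1 := by
    linear_combination -s * α * hA0 - t * β * hB0 + s * a1 * hα + t * b1 * hβ + c * hknot + m * hk
  have key3 : (s * t * (c * j + k * m + (X * α + Y * β)) : ℚ) = -m ^ 2 + s * a1 + t * b1 := by
    exact_mod_cast key2
  field_simp
  push_cast
  linear_combination key3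

end

/-! ### Quadratic forms -/

namespace Graph

variable {V : Type} [Fintype V]

lemma form_apply (Γ : Graph V) (x : V → ℝ) : Γ.form x = ∑ v, x v * ∑ u, Γ.M v u • x u := by
  simp [form, Matrix.toQuadraticForm', Matrix.toLinearMap₂'_apply', dotProduct, Matrix.mulVec]

lemma sum_extend (Γ : Graph V) [Fintype {v : V // v ≠ Γ.root}] (x : {v : V // v ≠ Γ.root} → ℝ)
    (g : V → ℝ) : ∑ v, Γ.extend x v * g v = ∑ v, x v * g v := by
  classical
  have : ∑ u, Γ.extend x u * g u = ∑ u with u ≠ Γ.root, Γ.extend x u * g u := by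
    refine (Finset.sum_filter_of_ne fun u _ hu => ?_).symm
    rintro rfl
    simp at hu
  rw [this, Finset.sum_subtype (p := fun u => u ≠ Γ.root) _ (by simp)]
  exact Finset.sum_congr rfl fun u _ => by simp

lemma form_extend (Γ : Graph V) [Fintype {v : V // v ≠ Γ.root}]
    (x : {v : V // v ≠ Γ.root} → ℝ) :
    star x ⬝ᵥ (-(Γ.Mhat.map (Int.cast : ℤ → ℝ))).mulVec x = -Γ.form (Γ.extend x) := by
  rw [form_apply, sum_extend]
  have h : ∀ v, ∑ u, (Γ.Mhat v u : ℝ) * x u = ∑ u, Γ.M v u • Γ.extend x u := fun v => by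
    simpa using Γ.sum_Mhat_smul x v
  simp only [Matrix.neg_mulVec, dotProduct_neg]
  simp [dotProduct, Matrix.mulVec, h]

lemma extend_restrict {W : Type} (Γ : Graph W) (x : W → ℝ) (hx : x Γ.root = 0) :
    Γ.extend (fun v => x v.1) = x := by
  classical
  funext v
  by_cases h : v = Γ.root
  · simp [h, hx]
  · simp [extend, h]

lemma Mhat_isHermitian {W : Type} (Γ : Graph W) :
    (-(Γ.Mhat.map (Int.cast : ℤ → ℝ))).IsHermitian := by
  ext u v
  have := congrFun (congrFun Γ.M_isSymm u.1) v.1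
  simp only [Matrix.transpose_apply] at this
  simp [Mhat, this]

lemma HatNegDef.form_neg {Γ : Graph V} (h : Γ.HatNegDef) {x : V → ℝ} (hx : x Γ.root = 0)
    (hx0 : x ≠ 0) : Γ.form x < 0 := by
  classical
  have := h.dotProduct_mulVec_pos (x := fun v => x v.1) (by
    intro h0
    apply hx0
    rw [← Γ.extend_restrict x hx, h0]
    funext v
    simp [extend])
  rw [form_extend, extend_restrict _ _ hx] at this
  linarith

lemma hatNegDef_of_form_nonpos {Γ : Graph V} [Fintype {v : V // v ≠ Γ.root}]
    [DecidableEq {v : V // v ≠ Γ.root}] (hdet : IsUnit Γ.Mhat.det)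
    (h : ∀ x : V → ℝ, x Γ.root = 0 → Γ.form x ≤ 0) : Γ.HatNegDef := by
  have hpsd : (-(Γ.Mhat.map (Int.cast : ℤ → ℝ))).PosSemidef :=
    .of_dotProduct_mulVec_nonneg Γ.Mhat_isHermitian fun x => by
      rw [form_extend]
      linarith [h (Γ.extend x) (by simp)]
  refine hpsd.posDef_iff_det_ne_zero.2 ?_
  rw [Matrix.det_neg]
  have h1 : (Γ.Mhat.map (Int.cast : ℤ → ℝ)).det = (Γ.Mhat.det : ℝ) := by
    simpa using ((Int.castRingHom ℝ).map_det Γ.Mhat).symm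
  rw [h1]
  refine mul_ne_zero (pow_ne_zero _ (by norm_num)) ?_
  exact_mod_cast hdet.ne_zero

/-- The inertia of a degenerate form which is negative definite on the hyperplane where the entry
at the distinguished vertex vanishes. -/
lemma posIndex_signature {Γ : Graph V} (h : Γ.HatNegDef) {w : V → ℤ} (hw : w Γ.root = 1)
    (hMw : Γ.M.mulVec w = 0) :
    Γ.posIndex = 0 ∧ Γ.signature = -((Fintype.card V : ℤ) - 1) := by
  classical
  have hMw' : ∀ v, ∑ u, Γ.M v u • (w u : ℝ) = 0 := fun v => by
    have := congrFun hMw v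
    simp only [Matrix.mulVec, dotProduct, Pi.zero_apply] at this
    simp only [zsmul_eq_mul]
    exact_mod_cast this
  have hMw'' : ∀ u, ∑ v, (w v : ℝ) * Γ.M v u = 0 := fun u => by
    rw [← hMw' u]
    refine Finset.sum_congr rfl fun v _ => ?_
    rw [zsmul_eq_mul, mul_comm, ← Γ.M_isSymm.apply]
  -- Translation along the kernel vector `w` moves any vector into the hyperplane where the form is
  -- negative definite. Hence the form is nonpositive; the line of `w` bounds the negative index
  -- above and the hyperplane bounds it below.
  have hinv : ∀ x : V → ℝ, Γ.form x = Γ.form (fun v => x v - x Γ.root * w v) := by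
    intro x
    have h1 : ∀ v, ∑ u, Γ.M v u • (x u - x Γ.root * w u) = ∑ u, Γ.M v u • x u := fun v => by
      have : ∀ u, Γ.M v u • (x u - x Γ.root * w u) =
          Γ.M v u • x u - x Γ.root * (Γ.M v u • (w u : ℝ)) := fun u => by
        simp only [zsmul_eq_mul]; ring
      rw [Finset.sum_congr rfl fun u _ => this u, Finset.sum_sub_distrib, ← Finset.mul_sum, hMw']
      simp
    have h2 : ∑ v, (w v : ℝ) * ∑ u, Γ.M v u • x u = 0 := by
      simp only [Finset.mul_sum]
      rw [Finset.sum_comm]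
      refine Finset.sum_eq_zero fun u _ => ?_
      have : ∀ v, (w v : ℝ) * Γ.M v u • x u = (w v * Γ.M v u : ℝ) * x u := fun v => by
        simp only [zsmul_eq_mul]; ring
      rw [Finset.sum_congr rfl fun v _ => this v, ← Finset.sum_mul, hMw'', zero_mul]
    simp only [form_apply, h1, sub_mul, Finset.sum_sub_distrib, mul_assoc, ← Finset.mul_sum, h2]
    simp
  have hnonpos : ∀ x, Γ.form x ≤ 0 := by
    intro x
    rw [hinv]
    by_cases h0 : (fun v => x v - x Γ.root * w v) = 0
    · rw [h0, map_zero]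
    · exact (h.form_neg (by simp [hw]) h0).le
  have hpos : sigPos Γ.form = 0 := by
    have := QuadraticForm.sigPos_add_finrank_le_of_nonpos (Q := Γ.form) (V := ⊤)
      fun x _ => hnonpos x
    rw [finrank_top] at this
    omega
  have hle : sigNeg Γ.form + 1 ≤ Fintype.card V := by
    have := QuadraticForm.sigPos_add_finrank_le_of_nonpos (Q := -Γ.form)
      (V := Submodule.span ℝ {fun v => (w v : ℝ)}) (by
        intro x hx
        obtain ⟨c, rfl⟩ := Submodule.mem_span_singleton.1 hx
        rw [neg_apply, QuadraticMap.map_smul, form_apply]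
        simp only [hMw', mul_zero, Finset.sum_const_zero, smul_zero, neg_zero, le_refl])
    rw [finrank_span_singleton (by
      intro h0
      have := congrFun h0 Γ.root
      simp [hw] at this)] at this
    simpa using this
  have hge : Fintype.card V - 1 ≤ sigNeg Γ.form := by
    have := le_sigNeg_of_negDef Γ.form
      (V := LinearMap.ker (LinearMap.proj (R := ℝ) (φ := fun _ : V => ℝ) Γ.root)) (by
        rintro ⟨x, hx⟩ hx0
        have := h.form_neg (x := x) (by simpa using hx) (by simpa using hx0)
        simpa using this)
    have h2 := LinearMap.finrank_range_add_finrank_ker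
      (LinearMap.proj (R := ℝ) (φ := fun _ : V => ℝ) Γ.root)
    rw [LinearMap.range_eq_top.2 (LinearMap.proj_surjective _), finrank_top] at h2
    simp at h2
    omega
  refine ⟨hpos, ?_⟩
  rw [signature, hpos]
  omega

end Graph

/-- The contribution of a leg to the quadratic form of a star. -/
def legForm : List ℤ → (ℕ → ℝ) → ℝ
  | [], _ => 0
  | e :: L, f => e * f 1 ^ 2 - 2 * f 0 * f 1 + legForm L fun i => f (i + 1)

lemma legForm_congr {L : List ℤ} {f g : ℕ → ℝ} (h : ∀ i ≤ L.length, f i = g i) :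
    legForm L f = legForm L g := by
  induction L generalizing f g with
  | nil => rfl
  | cons e L ih =>
    simp only [legForm]
    rw [h 0 (by simp), h 1 (by simp), ih fun i hi => h (i + 1) (by simpa using hi)]

lemma legForm_zero (L : List ℤ) : legForm L (fun _ => 0) = 0 := by
  induction L with
  | nil => rfl
  | cons e L ih => simp [legForm, ih]

lemma sum_legForm (L : List ℤ) (f : ℕ → ℝ) :
    ∑ i : Fin L.length, f (i.val + 1) * (L[i] • f (i.val + 1) + (f i.val + f (i.val + 2))) =
      -(legForm (L.map Neg.neg) f + f 0 * f 1) + f L.length * f (L.length + 1) := by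
  induction L generalizing f with
  | nil => simp [legForm]
  | cons e L ih =>
    have := ih fun i => f (i + 1)
    refine (Fin.sum_univ_succ (n := L.length) _).trans ?_
    simp only [Fin.getElem_fin, Fin.val_zero, Fin.val_succ, List.getElem_cons_zero,
      List.getElem_cons_succ, List.length_cons, List.map_cons, legForm, zero_add] at this ⊢
    have h2 : ∀ i, f (i + 1 + 2) = f (i + 2 + 1) := fun _ => rfl
    simp only [h2, this]
    push_cast [zsmul_eq_mul]
    ring

/-- Completing the square from the far end inwards: with `f 0` fixed, the leg contributes at least
the negative of its inverse continued fraction times `f 0 ^ 2`. -/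
lemma SuffixPos.legForm_ge {L : List ℤ} (h : SuffixPos L) (f : ℕ → ℝ) :
    -((chainMatrix L 1 0 : ℝ) / chainMatrix L 0 0 * f 0 ^ 2) ≤ legForm L f := by
  induction L generalizing f with
  | nil => simp [legForm]
  | cons e L ih =>
    have h1 := ih h.2 fun i => f (i + 1)
    have hK : (0 : ℝ) < chainMatrix L 0 0 := by exact_mod_cast h.2.pos
    have hK' : (0 : ℝ) < chainMatrix (e :: L) 0 0 := by exact_mod_cast h.1
    simp only [legForm, chainMatrix_cons_zero, chainMatrix_cons_one, zero_add] at h1 hK' ⊢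
    push_cast at hK' ⊢
    generalize legForm L _ = q at *
    generalize (chainMatrix L 0 0 : ℝ) = k at *
    generalize (chainMatrix L 1 0 : ℝ) = k' at *
    have : e * f 1 ^ 2 - 2 * f 0 * f 1 - k' / k * f 1 ^ 2 + k / (e * k - k') * f 0 ^ 2 =
        ((e * k - k') * f 1 - k * f 0) ^ 2 / (k * (e * k - k')) := by
      field_simp
      ring
    have h2 : 0 ≤ ((e * k - k') * f 1 - k * f 0) ^ 2 / (k * (e * k - k')) := by positivity
    linarith

lemma SuffixPos.exists_legForm_eq {L : List ℤ} (h : SuffixPos L) (x : ℝ) :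
    ∃ f : ℕ → ℝ, f 0 = x ∧
      legForm L f = -((chainMatrix L 1 0 : ℝ) / chainMatrix L 0 0 * x ^ 2) := by
  induction L generalizing x with
  | nil => exact ⟨fun _ => x, rfl, by simp [legForm]⟩
  | cons e L ih =>
    have hK : (0 : ℝ) < chainMatrix L 0 0 := by exact_mod_cast h.2.pos
    have hK' : (0 : ℝ) < chainMatrix (e :: L) 0 0 := by exact_mod_cast h.1
    -- This value at the first leg vertex is the zero of the completed square in
    -- `SuffixPos.legForm_ge`.
    obtain ⟨f, hf0, hf⟩ := ih h.2 ((chainMatrix L 0 0 : ℝ) / chainMatrix (e :: L) 0 0 * x)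
    refine ⟨fun | 0 => x | i + 1 => f i, rfl, ?_⟩
    simp only [legForm, hf0, chainMatrix_cons_zero, chainMatrix_cons_one] at hf hK' ⊢
    rw [hf]
    push_cast at hK' ⊢
    generalize (chainMatrix L 0 0 : ℝ) = k at *
    generalize (chainMatrix L 1 0 : ℝ) = k' at *
    field_simp
    ring

lemma suffixPos_of_legForm_pos {L : List ℤ}
    (h : ∀ f : ℕ → ℝ, f 0 = 0 → (∃ i < L.length, f (i + 1) ≠ 0) → 0 < legForm L f) :
    SuffixPos L := by
  induction L with
  | nil => trivial
  | cons e L ih =>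
    have hL : SuffixPos L := ih fun f hf0 ⟨i, hi, hfi⟩ => by
      have := h (fun | 0 => 0 | i + 1 => f i) rfl ⟨i + 1, by simpa using hi, hfi⟩
      simpa [legForm, hf0] using this
    refine ⟨?_, hL⟩
    obtain ⟨f, hf0, hf⟩ := hL.exists_legForm_eq 1
    -- The test vector is one at the first vertex and minimal beyond it. The form takes there the
    -- value of the new continuant divided by that of the tail.
    have := h (fun | 0 => 0 | i + 1 => f i) rfl ⟨0, by simp, by simp [hf0]⟩
    have hK : (0 : ℝ) < chainMatrix L 0 0 := by exact_mod_cast hL.pos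
    simp only [legForm, hf0, hf] at this
    rw [chainMatrix_cons_zero]
    have h2 : (0 : ℝ) < e * chainMatrix L 0 0 - chainMatrix L 1 0 := by
      have := mul_pos hK this
      field_simp at this
      linarith
    exact_mod_cast h2

section

variable {s t : ℕ} {A B : List ℤ}

lemma torusGraph_form (x : StarVert A.length B.length → ℝ) (hx : x knot = 0) :
    (torusGraph s t A B).form x = -(x center ^ 2 + legForm (A.map Neg.neg) (valA x) +
      legForm (B.map Neg.neg) (valB x)) := by
  have hA := sum_legForm A (valA x)
  have hB := sum_legForm B (valB x)
  rw [Graph.form_apply]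
  have hS : ∀ S : StarVert A.length B.length → ℝ, ∑ v, x v * S v =
      (x center * S center + x knot * S knot) +
        (∑ i, x (legA i) * S (legA i) + ∑ j, x (legB j) * S (legB j)) := fun S => by
    simp [Fintype.sum_sum_type]
  have hxA : ∀ i, x (legA i) = valA x (i.val + 1) := fun i => by simp [valA]
  have hxB : ∀ i, x (legB i) = valB x (i.val + 1) := fun i => by simp [valB]
  have hA0 : valA x 0 = x center := rfl
  have hB0 : valB x 0 = x center := rfl
  have hA1 : valA x (A.length + 1) = 0 := by simp [valA]
  have hB1 : valB x (B.length + 1) = 0 := by simp [valB]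
  rw [hS]
  simp only [sum_M_legA, sum_M_legB, sum_M_center, hxA, hxB, hA, hB, hx, hA0, hB0, hA1, hB1]
  ring

lemma suffixPos_of_hatNegDef (h : (torusGraph s t A B).HatNegDef) :
    SuffixPos (A.map Neg.neg) ∧ SuffixPos (B.map Neg.neg) := by
  constructor
  · refine suffixPos_of_legForm_pos fun f hf0 ⟨i, hi, hfi⟩ => ?_
    let x : StarVert A.length B.length → ℝ := Sum.elim 0 (Sum.elim (fun i => f (i.val + 1)) 0)
    have hx := h.form_neg (x := x) rfl fun h0 =>
      hfi (congrFun h0 (legA ⟨i, by simpa using hi⟩))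
    have hA : legForm (A.map Neg.neg) (valA x) = legForm (A.map Neg.neg) f :=
      legForm_congr fun i hi => by
        cases i with
        | zero => exact hf0.symm
        | succ i => simp only [List.length_map] at hi; simp [valA, legExt, x, Nat.lt_of_succ_le hi]
    have hB : legForm (B.map Neg.neg) (valB x) = legForm (B.map Neg.neg) fun _ => 0 :=
      legForm_congr fun i hi => by
        cases i with
        | zero => rfl
        | succ i => simp [valB, legExt, x]
    rw [torusGraph_form x rfl, hA, hB, legForm_zero, show x center = 0 from rfl] at hx
    linarith
  · refine suffixPos_of_legForm_pos fun f hf0 ⟨i, hi, hfi⟩ => ?_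
    let x : StarVert A.length B.length → ℝ := Sum.elim 0 (Sum.elim 0 (fun i => f (i.val + 1)))
    have hx := h.form_neg (x := x) rfl fun h0 =>
      hfi (congrFun h0 (legB ⟨i, by simpa using hi⟩))
    have hB : legForm (B.map Neg.neg) (valB x) = legForm (B.map Neg.neg) f :=
      legForm_congr fun i hi => by
        cases i with
        | zero => exact hf0.symm
        | succ i => simp only [List.length_map] at hi; simp [valB, legExt, x, Nat.lt_of_succ_le hi]
    have hA : legForm (A.map Neg.neg) (valA x) = legForm (A.map Neg.neg) fun _ => 0 :=
      legForm_congr fun i hi => by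
        cases i with
        | zero => rfl
        | succ i => simp [valA, legExt, x]
    rw [torusGraph_form x rfl, hA, hB, legForm_zero, show x center = 0 from rfl] at hx
    linarith

/-- After minimising over the legs, the coefficient left at the centre is `1 - a/t - b/s = 1/(st)`,
with `a`, `b` the continuants of the legs without their first entries. Semidefiniteness is enough,
by unimodularity. -/
lemma TorusLegs.hatNegDef (h : TorusLegs s t A B) (hs : 0 < s) (ht : 0 < t) :
    (torusGraph s t A B).HatNegDef := by
  classical
  refine Graph.hatNegDef_of_form_nonpos h.isUnit_det fun x hx => ?_
  rw [torusGraph_form x hx, neg_nonpos]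
  have hA := h.posA.legForm_ge (valA x)
  have hB := h.posB.legForm_ge (valB x)
  rw [h.detA, show valA x 0 = x center from rfl] at hA
  rw [h.detB, show valB x 0 = x center from rfl] at hB
  have hrel : (s * chainMatrix (A.map Neg.neg) 1 0 + t * chainMatrix (B.map Neg.neg) 1 0 + 1 : ℝ) =
    s * t := by exact_mod_cast h.det_chain
  generalize chainMatrix (A.map Neg.neg) 1 0 = a at *
  generalize chainMatrix (B.map Neg.neg) 1 0 = b at *
  have hs' : (0 : ℝ) < s := by exact_mod_cast hs
  have ht' : (0 : ℝ) < t := by exact_mod_cast ht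
  have key : (1 - a / t - b / s : ℝ) = 1 / (s * t) := by
    field_simp
    linarith
  have h2 : 0 ≤ (1 - a / t - b / s : ℝ) * x center ^ 2 := by rw [key]; positivity
  push_cast at hA hB
  nlinarith

end

/-! ### Continued fractions and torus knot diagrams -/

lemma contFrac_eq {A : List ℤ} (h : SuffixPos (A.map Neg.neg)) :
    contFrac A = -(chainMatrix (A.map Neg.neg) 0 0 / chainMatrix (A.map Neg.neg) 1 0 : ℚ) := by
  induction A with
  | nil => simp [contFrac]
  | cons k A ih =>
    have hK : (0 : ℚ) < chainMatrix (A.map Neg.neg) 0 0 := by exact_mod_cast h.2.pos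
    rw [contFrac, ih h.2]
    simp only [List.map_cons, chainMatrix_cons_zero, chainMatrix_cons_one]
    push_cast
    field_simp
    ring

/-- A positive definite chain is determined by its continued fraction in lowest terms. -/
lemma chainMatrix_eq_of_contFrac {A : List ℤ} {p q u : ℕ} (h : SuffixPos (A.map Neg.neg))
    (hp : 0 < p) (hq : 0 < q) (hpq : p ∣ u * q + 1) (hf : contFrac A = -(p : ℚ) / q) :
    chainMatrix (A.map Neg.neg) 0 0 = p ∧ chainMatrix (A.map Neg.neg) 1 0 = q := by
  have hK := h.pos
  rw [contFrac_eq h, neg_div, neg_inj] at hf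
  have hdet := chainMatrix_det (A.map Neg.neg)
  generalize chainMatrix (A.map Neg.neg) 0 0 = a at *
  generalize chainMatrix (A.map Neg.neg) 1 0 = b at *
  generalize chainMatrix (A.map Neg.neg) 0 1 = c at *
  generalize chainMatrix (A.map Neg.neg) 1 1 = d at *
  have hq' : (0 : ℚ) < q := by exact_mod_cast hq
  have hp' : (0 : ℚ) < p := by exact_mod_cast hp
  have hb : (b : ℚ) ≠ 0 := by
    intro hb
    rw [hb, div_zero] at hf
    have : (0 : ℚ) < p / q := by positivity
    linarith
  have hcross : a * q = p * b := by
    rw [div_eq_div_iff hb hq'.ne'] at hf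
    exact_mod_cast hf
  have hab : IsCoprime a b := ⟨d, -c, by linarith⟩
  have hpq' : IsCoprime (p : ℤ) q := by
    obtain ⟨k, hk⟩ := hpq
    refine ⟨k, -u, ?_⟩
    have : (u * q + 1 : ℤ) = p * k := by exact_mod_cast hk
    linarith
  have h1 : a ∣ p := hab.dvd_of_dvd_mul_right ⟨q, hcross.symm⟩
  have h2 : (p : ℤ) ∣ a := hpq'.dvd_of_dvd_mul_right ⟨b, hcross⟩
  have hap : a = p := Int.dvd_antisymm hK.le (by positivity) h1 h2
  refine ⟨hap, ?_⟩
  rw [hap] at hcross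
  exact (mul_left_cancel₀ (by exact_mod_cast hp.ne') hcross).symm

/-- Hirzebruch–Jung expansion: division with remainder rounded up, `p = e q - r` with `0 ≤ r < q`.
-/
lemma exists_chainMatrix_eq (q : ℕ) : ∀ p : ℕ, q < p → Nat.Coprime p q →
    ∃ L : List ℤ, (∀ a ∈ L, 2 ≤ a) ∧ chainMatrix L 0 0 = p ∧ chainMatrix L 1 0 = q := by
  induction q using Nat.strong_induction_on with
  | _ q ih =>
    intro p hqp hpq
    rcases Nat.eq_zero_or_pos q with rfl | hq
    · have : p = 1 := by simpa using hpq
      exact ⟨[], by simp, by simp [this], by simp⟩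
    · obtain ⟨e, r, hr, he⟩ : ∃ e r : ℕ, r < q ∧ p + r = e * q := by
        refine ⟨(p + q - 1) / q, q - 1 - (p + q - 1) % q, by omega, ?_⟩
        have := Nat.div_add_mod (p + q - 1) q
        have := Nat.mod_lt (p + q - 1) hq
        rw [mul_comm]
        omega
      have hco : Nat.Coprime q r := by
        rw [Nat.coprime_comm] at hpq
        have h1 : Nat.gcd q r ∣ p := by
          have h2 : Nat.gcd q r ∣ p + r := he ▸ (Nat.gcd_dvd_left q r).mul_left e
          exact (Nat.dvd_add_left (Nat.gcd_dvd_right q r)).1 h2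
        exact Nat.eq_one_of_dvd_one (hpq ▸ Nat.dvd_gcd (Nat.gcd_dvd_left q r) h1)
      obtain ⟨L, hL, h0, h1⟩ := ih r hr q hr hco
      refine ⟨e :: L, ?_, ?_, ?_⟩
      · have : 2 ≤ e := by
          by_contra! h
          interval_cases e <;> omega
        simp only [List.mem_cons, forall_eq_or_imp]
        exact ⟨by exact_mod_cast this, hL⟩
      · rw [chainMatrix_cons_zero, h0, h1]
        have : (p + r : ℤ) = e * q := by exact_mod_cast he
        linarith
      · rw [chainMatrix_cons_one, h0]

lemma exists_neg_inverse {s t : ℕ} (ht : 1 < t) (hst : Nat.Coprime s t) :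
    ∃ t' : ℕ, 0 < t' ∧ t' < t ∧ t ∣ s * t' + 1 := by
  obtain ⟨m, -, hm⟩ := Nat.exists_mul_mod_eq_one_of_coprime hst ht
  have hlt := Nat.mod_lt m (by omega : t > 0)
  refine ⟨t - m % t, by omega, ?_, ?_⟩
  · have : m % t ≠ 0 := by
      intro h0
      rw [Nat.mul_mod, h0] at hm
      simp at hm
    omega
  · have h1 : (s * (m % t)) % t = 1 := by rw [← hm, Nat.mul_mod, Nat.mod_mod, ← Nat.mul_mod]
    have h2 := Nat.div_add_mod (s * (m % t)) t
    rw [h1] at h2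
    have : (t : ℤ) ∣ ((s * (t - m % t) + 1 : ℕ) : ℤ) := by
      push_cast [Nat.cast_sub hlt.le]
      refine ⟨s - ((s * (m % t) / t : ℕ) : ℤ), ?_⟩
      have h3 : (t * ((s * (m % t) / t : ℕ) : ℤ) + 1 : ℤ) = s * ((m % t : ℕ) : ℤ) := by
        exact_mod_cast h2
      push_cast at h3 ⊢
      linarith
    exact_mod_cast this

/-- The left side is divisible by both `s` and `t`, positive, and smaller than `2st`. -/
lemma neg_inverse_add {s t s' t' : ℕ} (hs : 1 < s) (ht : 1 < t) (hst : Nat.Coprime s t)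
    (ht' : t' < t) (htd : t ∣ s * t' + 1) (hs' : s' < s) (hsd : s ∣ t * s' + 1) :
    s * t' + t * s' + 1 = s * t := by
  have h1 : s * t ∣ s * t' + t * s' + 1 := by
    refine hst.mul_dvd_of_dvd_of_dvd ?_ ?_
    · have := (Dvd.intro t' rfl : s ∣ s * t').add hsd
      rwa [← add_assoc] at this
    · have := htd.add (Dvd.intro s' rfl : t ∣ t * s')
      rwa [show s * t' + t * s' + 1 = s * t' + 1 + t * s' by ring]
  obtain ⟨k, hk⟩ := h1
  have h3 : s * t' + s ≤ s * t := by nlinarith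
  have h4 : t * s' + t ≤ s * t := by nlinarith
  have hk1 : k < 2 := by
    by_contra! h
    nlinarith [Nat.mul_le_mul_left (s * t) h]
  interval_cases k <;> omega

lemma IsTorusDiagram.torusLegs {s t : ℕ} {A B : List ℤ} (h : IsTorusDiagram s t A B)
    (hs : 1 < s) (ht : 1 < t) (hst : Nat.Coprime s t) : TorusLegs s t A B := by
  obtain ⟨hA, hB⟩ := suffixPos_of_hatNegDef h.negDef
  obtain ⟨t', ht0, ht', htd, hfA⟩ := h.fracA
  obtain ⟨s', hs0, hs', hsd, hfB⟩ := h.fracB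
  obtain ⟨hA0, hA1⟩ := chainMatrix_eq_of_contFrac hA (by omega) ht0 htd hfA
  obtain ⟨hB0, hB1⟩ := chainMatrix_eq_of_contFrac hB (by omega) hs0 hsd hfB
  refine ⟨hA, hB, hA0, hB0, ?_, ?_, ?_⟩
  · rw [hA1, hB1]
    exact_mod_cast neg_inverse_add hs ht hst ht' htd hs' hsd
  · rintro rfl
    simp at hA0
    omega
  · rintro rfl
    simp at hB0
    omega

lemma exists_isTorusDiagram {s t : ℕ} (hs : 1 < s) (ht : 1 < t) (hst : Nat.Coprime s t) :
    ∃ A B, IsTorusDiagram s t A B := by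
  obtain ⟨t', ht0, ht', htd⟩ := exists_neg_inverse ht hst
  obtain ⟨s', hs0, hs', hsd⟩ := exists_neg_inverse hs hst.symm
  have hco : ∀ p q u : ℕ, p ∣ u * q + 1 → Nat.Coprime p q := fun p q u h => by
    have h1 : Nat.gcd p q ∣ u * q + 1 := (Nat.gcd_dvd_left p q).trans h
    exact Nat.eq_one_of_dvd_one
      ((Nat.dvd_add_right ((Nat.gcd_dvd_right p q).mul_left u)).1 h1)
  obtain ⟨L, hL, hL0, hL1⟩ := exists_chainMatrix_eq t' t ht' (hco _ _ _ htd)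
  obtain ⟨N, hN, hN0, hN1⟩ := exists_chainMatrix_eq s' s hs' (hco _ _ _ hsd)
  have hneg : ∀ L : List ℤ, (L.map Neg.neg).map Neg.neg = L := fun L => by simp
  have hL' := (suffixPos_of_two_le hL).1
  have hN' := (suffixPos_of_two_le hN).1
  have hlegs : TorusLegs s t (L.map Neg.neg) (N.map Neg.neg) := by
    refine ⟨by rwa [hneg], by rwa [hneg], by rw [hneg, hL0], by rw [hneg, hN0], ?_, ?_, ?_⟩
    · rw [hneg, hneg, hL1, hN1]
      exact_mod_cast neg_inverse_add hs ht hst ht' htd hs' hsd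
    · rintro h
      obtain rfl : L = [] := by simpa using h
      simp at hL0
      omega
    · rintro h
      obtain rfl : N = [] := by simpa using h
      simp at hN0
      omega
  refine ⟨L.map Neg.neg, N.map Neg.neg, ?_, ?_, ⟨t', ht0, ht', htd, ?_⟩, ⟨s', hs0, hs', hsd, ?_⟩,
    hlegs.hatNegDef (by omega) (by omega)⟩
  · intro k hk
    obtain ⟨a, ha, rfl⟩ := List.mem_map.1 hk
    have := hL a ha
    omega
  · intro k hk
    obtain ⟨a, ha, rfl⟩ := List.mem_map.1 hk
    have := hN a ha
    omega
  · rw [contFrac_eq hlegs.posA, hneg, hL0, hL1, neg_div]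
    simp
  · rw [contFrac_eq hlegs.posB, hneg, hN0, hN1, neg_div]
    simp

/-! ### Seifert framing and self-conjugate structures -/

section

variable {s t : ℕ} {A B : List ℤ}

/-- Unimodularity solves the equation away from `v₀`. At `v₀`, `TorusLegs.mulVec_knot` with centre
value one and zero ends gives `-st`, which is exactly the framing. -/
lemma TorusLegs.exists_seifert (h : TorusLegs s t A B) :
    ∃ w : StarVert A.length B.length → ℤ, w knot = 0 ∧
      (torusGraph s t A B).M.mulVec (Pi.single knot 1) = (torusGraph s t A B).M.mulVec w := by
  obtain ⟨w, hw0, hw⟩ := h.exists_mulVec_eq ((torusGraph s t A B).M.mulVec (Pi.single knot 1))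
  refine ⟨w, hw0, ?_⟩
  have hk : ∀ y, (torusGraph s t A B).M.mulVec y knot = _ := fun y => sum_M_knot y
  have hlA : ∀ i, (torusGraph s t A B).M.mulVec (Pi.single knot 1) (legA i) = 0 := by
    simp [torusGraph, Graph.M]
  have hlB : ∀ i, (torusGraph s t A B).M.mulVec (Pi.single knot 1) (legB i) = 0 := by
    simp [torusGraph, Graph.M]
  have hend : EndSupported ((torusGraph s t A B).M.mulVec w) 0 0 :=
    ⟨fun i => by rw [hw _ (by simp), hlA]; simp, fun i => by rw [hw _ (by simp), hlB]; simp⟩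
  have hwk := h.mulVec_knot hend
  have hcc : (torusGraph s t A B).M.mulVec (Pi.single knot 1) center = 1 := by
    simp [torusGraph, Graph.M]
  rw [hw center (by simp), hcc] at hwk
  funext v
  by_cases hv : v = knot
  · subst hv
    rw [hwk, hk]
    simp
  · exact (hw v hv).symm

lemma TorusLegs.exists_kernel (h : TorusLegs s t A B) :
    ∃ w : StarVert A.length B.length → ℤ, w knot = 1 ∧ (torusGraph s t A B).M.mulVec w = 0 := by
  obtain ⟨w, hw0, hw⟩ := h.exists_seifert
  exact ⟨Pi.single knot 1 - w, by simp [hw0], by rw [Matrix.mulVec_sub, hw, sub_self]⟩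

lemma TorusLegs.isSeifertFramed (h : TorusLegs s t A B)
    (hneg : (torusGraph s t A B).HatNegDef) : (torusGraph s t A B).IsSeifertFramed where
  isTree := torusGraph_isTree h.neA h.neB
  root_deg := deg_knot
  negDef := hneg
  homologySphere := by convert h.isUnit_det
  seifert := by
    obtain ⟨w, hw0, hw⟩ := h.exists_seifert
    refine ⟨w, hw0, ?_⟩
    convert hw
    rfl

lemma Graph.IsSelfConj.exists_eq {V : Type} [Fintype V] {Γ : Graph V} {a : V → ℤ}
    (ha : Γ.IsSelfConj a) : ∃ b : V → ℤ, b Γ.root = 0 ∧ a = Γ.M.mulVec b := by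
  obtain ⟨w, hw0, hw⟩ := ha.2
  refine ⟨w, hw0, ?_⟩
  funext v
  have := congrFun hw v
  simp at this
  omega

lemma TorusLegs.exists_isSelfConj (h : TorusLegs s t A B) (hst : Nat.Coprime s t) :
    ∃ a, (torusGraph s t A B).IsSelfConj a := by
  -- Ones at the centre and the leg ends and zeros between have the parity of the degrees. The entry
  -- at `v₀` is then `-(st + s + t)`, odd because `(s + 1)(t + 1)` is even for coprime `s`, `t`.
  obtain ⟨b, hb0, hb⟩ := h.exists_mulVec_eq (Sum.elim 1
    (Sum.elim (fun i => if i.val + 1 = A.length then 1 else 0)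
      (fun i => if i.val + 1 = B.length then 1 else 0)))
  have hend : EndSupported ((torusGraph s t A B).M.mulVec b) 1 1 :=
    ⟨fun i => by rw [hb _ (by simp)]; rfl, fun i => by rw [hb _ (by simp)]; rfl⟩
  refine ⟨(torusGraph s t A B).M.mulVec b, ?_, b, hb0, by simp [two_smul]⟩
  have hk := h.mulVec_knot hend
  rw [hb center (by simp)] at hk
  rintro ((_ | _) | (i | j))
  · rw [deg_center h.neA h.neB, hb _ (by simp)]
    rfl
  · rw [deg_knot]
    change (torusGraph s t A B).M.mulVec b knot ≡ _ [ZMOD 2]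
    rw [hk]
    simp only [Sum.elim_inl, Pi.one_apply, mul_one]
    have hpar : ¬(2 ∣ s ∧ 2 ∣ t) := fun ⟨h1, h2⟩ => by
      have := Nat.dvd_gcd h1 h2
      rw [hst] at this
      omega
    have : (s * t + s + t + 1) % 2 = 0 := by
      rw [show s * t + s + t + 1 = (s + 1) * (t + 1) by ring, Nat.mul_mod]
      rcases Nat.mod_two_eq_zero_or_one s with h1 | h1 <;>
        rcases Nat.mod_two_eq_zero_or_one t with h2 | h2 <;> simp [Nat.add_mod, h1, h2]
      omega
    have : ((s * t + s + t + 1 : ℕ) : ℤ) % 2 = 0 := by exact_mod_cast this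
    push_cast at this
    unfold Int.ModEq
    omega
  · rw [deg_legA, hend.legA]
    split_ifs <;> rfl
  · rw [deg_legB, hend.legB]
    split_ifs <;> rfl

end

/-! ### Coefficients of principal values -/

lemma pvCoeff_zero (j : ℤ) : pvCoeff 0 j = if j = 0 then 1 else 0 := by
  by_cases h : j = 0 <;> simp [pvCoeff, HahnSeries.coeff_one, h]
  norm_num

lemma pvCoeff_one (j : ℤ) :
    pvCoeff 1 j = (if j = 1 then 1 else 0) - (if j = -1 then 1 else 0) := by
  have h1 : -j = -1 ↔ j = 1 := by omega
  have h2 : -j = 1 ↔ j = -1 := by omega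
  simp only [pvCoeff, zpow_one, HahnSeries.coeff_sub, HahnSeries.coeff_single, h1, h2]
  split_ifs <;> ring

lemma inv_single_sub_single :
    (HahnSeries.single 1 1 - HahnSeries.single (-1) 1 : LaurentSeries ℚ)⁻¹ =
      -(HahnSeries.single 1 1 *
        HahnSeries.ofPowerSeries ℤ ℚ (PowerSeries.mk fun n => if Even n then 1 else 0)) := by
  refine inv_eq_of_mul_eq_one_right ?_
  set P : PowerSeries ℚ := PowerSeries.mk fun n => if Even n then 1 else 0 with hP
  have hPX : P * (1 - PowerSeries.X ^ 2) = 1 := by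
    ext n
    rw [mul_sub, mul_one, map_sub, PowerSeries.coeff_mul_X_pow', PowerSeries.coeff_one, hP,
      PowerSeries.coeff_mk, PowerSeries.coeff_mk]
    rcases n with _ | _ | n
    · simp
    · simp
    · simp [Nat.even_add]
  have h1 : (HahnSeries.single (-1) 1 * HahnSeries.single 1 1 : LaurentSeries ℚ) = 1 := by
    rw [HahnSeries.single_mul_single]; simp
  have h2 := congrArg (HahnSeries.ofPowerSeries ℤ ℚ) hPX
  rw [map_mul, map_sub, map_one, map_pow, HahnSeries.ofPowerSeries_X] at h2
  linear_combination h2 + HahnSeries.ofPowerSeries ℤ ℚ P * h1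

/-- The expansions are `-(z + z³ + ⋯)` at zero and `z⁻¹ + z⁻³ + ⋯` at infinity; their average is odd
in `j`. -/
lemma pvCoeff_neg_one (j : ℤ) : pvCoeff (-1) j = if Odd j then -(j.sign : ℚ) / 2 else 0 := by
  have hc : ∀ j : ℤ,
      (HahnSeries.single 1 1 - HahnSeries.single (-1) 1 : LaurentSeries ℚ)⁻¹.coeff j =
      if 0 < j ∧ Odd j then -1 else 0 := fun j => by
    rw [inv_single_sub_single, HahnSeries.coeff_neg, HahnSeries.coeff_single_mul,
      PowerSeries.coeff_coe, one_mul, PowerSeries.coeff_mk]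
    have hpar : Even (j - 1).natAbs ↔ Odd j := by
      rw [Int.natAbs_even, Int.even_sub_one, Int.not_even_iff_odd]
    have hj : j - 1 < 0 ↔ ¬0 < j := by omega
    simp only [hpar, hj]
    by_cases h1 : 0 < j <;> by_cases h2 : Odd j <;> simp [h1, h2]
  have hneg : (HahnSeries.single (-1) 1 - HahnSeries.single 1 1 : LaurentSeries ℚ) =
      -(HahnSeries.single 1 1 - HahnSeries.single (-1) 1) := by ring
  have hinv : ∀ u : LaurentSeries ℚ, (-u)⁻¹ = -u⁻¹ := fun u => inv_neg
  rw [pvCoeff, hneg, zpow_neg_one, zpow_neg_one, hinv, HahnSeries.coeff_neg, hc, hc]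
  by_cases h2 : Odd j
  · rcases lt_trichotomy j 0 with h | rfl | h
    · simp [h, h2, h.not_gt, Int.sign_eq_neg_one_of_neg h]
    · simp at h2
    · simp [h, h2, h.not_gt, Int.sign_eq_one_of_pos h]
      norm_num
  · simp [h2]

/-! ### The signs -/

lemma add_lt_mul_of_coprime {s t : ℕ} (hs : 1 < s) (ht : 1 < t) (hst : Nat.Coprime s t) :
    s + t < s * t := by
  have hne : s ≠ t := by
    rintro rfl
    simp at hst
    omega
  rcases Nat.lt_or_gt_of_ne hne with h | h <;> nlinarith

section

variable {s t : ℕ} {j j' α β α' β' : ℤ}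

/-- A difference of odd `j`'s is even, so distinct ones move the index by at least `2st`, more than
the `2(s + t)` by which the signs can compensate. With `j` equal, the signs agree because `s` and
`t` are positive and distinct. -/
lemma star_index_injective (hs : 1 < s) (ht : 1 < t) (hst : Nat.Coprime s t)
    (hj : Odd j) (hj' : Odd j') (hα : α = 1 ∨ α = -1) (hβ : β = 1 ∨ β = -1)
    (hα' : α' = 1 ∨ α' = -1) (hβ' : β' = 1 ∨ β' = -1)
    (h : s * t * j + s * α + t * β = s * t * j' + s * α' + t * β') :
    j = j' ∧ α = α' ∧ β = β' := by
  have hlt : (s + t : ℤ) < s * t := by exact_mod_cast add_lt_mul_of_coprime hs ht hst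
  have hne : (s : ℤ) ≠ t := by
    intro h
    have : s = t := by exact_mod_cast h
    subst this
    simp at hst
    omega
  have hs' : (0 : ℤ) < s := by exact_mod_cast (by omega : 0 < s)
  have ht' : (0 : ℤ) < t := by exact_mod_cast (by omega : 0 < t)
  obtain ⟨a, rfl⟩ := hj
  obtain ⟨b, rfl⟩ := hj'
  have hab : a = b := by
    have h1 : (2 * s * t : ℤ) * (a - b) = s * (α' - α) + t * (β' - β) := by linarith
    have h2 : -(2 * s + 2 * t : ℤ) ≤ s * (α' - α) + t * (β' - β) ∧
        s * (α' - α) + t * (β' - β) ≤ 2 * s + 2 * t := by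
      rcases hα with rfl | rfl <;> rcases hβ with rfl | rfl <;> rcases hα' with rfl | rfl <;>
        rcases hβ' with rfl | rfl <;> constructor <;> linarith
    rw [← h1] at h2
    have h3 : a - b < 1 := by
      by_contra! h3
      nlinarith
    have h4 : -1 < a - b := by
      by_contra! h4
      nlinarith
    omega
  subst hab
  have h2 : s * (α - α') = t * (β' - β) := by linarith
  refine ⟨rfl, ?_⟩
  rcases hα with rfl | rfl <;> rcases hβ with rfl | rfl <;> rcases hα' with rfl | rfl <;>
    rcases hβ' with rfl | rfl <;> simp <;> apply hne <;> linarith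

lemma sign_star_index (hs : 1 < s) (ht : 1 < t) (hst : Nat.Coprime s t)
    (hj : Odd j) (hα : α = 1 ∨ α = -1) (hβ : β = 1 ∨ β = -1) :
    Int.sign (-(s * t * j + s * α + t * β)) = -Int.sign j := by
  have hlt : (s + t : ℤ) < s * t := by exact_mod_cast add_lt_mul_of_coprime hs ht hst
  have hs' : (0 : ℤ) < s := by exact_mod_cast (by omega : 0 < s)
  have ht' : (0 : ℤ) < t := by exact_mod_cast (by omega : 0 < t)
  have h1 : -(s + t : ℤ) ≤ s * α + t * β ∧ s * α + t * β ≤ s + t := by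
    rcases hα with rfl | rfl <;> rcases hβ with rfl | rfl <;> constructor <;> linarith
  rw [Int.sign_neg, neg_inj]
  rcases lt_trichotomy j 0 with h | rfl | h
  · rw [Int.sign_eq_neg_one_of_neg h, Int.sign_eq_neg_one_iff_neg]
    nlinarith
  · simp at hj
  · rw [Int.sign_eq_one_of_pos h, Int.sign_eq_one_iff_pos]
    nlinarith

/-- The integers congruent to `-(st + sα + tβ)` modulo `2st`. -/
def starIndices (s t : ℕ) (α β : ℤ) : Set ℤ :=
  {m | ∃ j : ℤ, Odd j ∧ m = -(s * t * j + s * α + t * β)}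

lemma mem_starIndices_iff {m : ℤ} (s t : ℕ) (α β : ℤ) :
    m ∈ starIndices s t α β ↔ m ≡ s * t - s * α - t * β [ZMOD 2 * s * t] := by
  rw [Int.modEq_comm, Int.modEq_iff_dvd]
  constructor
  · rintro ⟨_, ⟨a, rfl⟩, rfl⟩
    exact ⟨-a - 1, by ring⟩
  · rintro ⟨k, hk⟩
    exact ⟨2 * (-k - 1) + 1, ⟨_, rfl⟩, by linear_combination hk⟩

open Classical in
lemma torusSign_eq (s t : ℕ) (m : ℤ) : torusSign s t m =
    if m ∈ starIndices s t (-1) (-1) ∨ m ∈ starIndices s t 1 1 then -1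
    else if m ∈ starIndices s t (-1) 1 ∨ m ∈ starIndices s t 1 (-1) then 1 else 0 := by
  simp only [mem_starIndices_iff, torusSign, mul_neg, mul_one, sub_neg_eq_add]

lemma neg_mem_starIndices {m : ℤ} :
    -m ∈ starIndices s t α β ↔ m ∈ starIndices s t (-α) (-β) := by
  constructor
  · rintro ⟨j, hj, h⟩
    exact ⟨-j, hj.neg, by linear_combination -h⟩
  · rintro ⟨j, hj, h⟩
    exact ⟨-j, hj.neg, by linear_combination -h⟩

lemma torusSign_neg (m : ℤ) : torusSign s t (-m) = torusSign s t m := by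
  classical
  rw [torusSign_eq, torusSign_eq]
  refine if_congr ?_ rfl (if_congr ?_ rfl rfl) <;>
    rw [neg_mem_starIndices, neg_mem_starIndices, neg_neg, or_comm]

lemma torusSign_star_index (hs : 1 < s) (ht : 1 < t) (hst : Nat.Coprime s t)
    (hj : Odd j) (hα : α = 1 ∨ α = -1) (hβ : β = 1 ∨ β = -1) :
    torusSign s t (-(s * t * j + s * α + t * β)) = -(α * β) := by
  have h : ∀ α' β' : ℤ, (α' = 1 ∨ α' = -1) → (β' = 1 ∨ β' = -1) →
      (-(s * t * j + s * α + t * β) ∈ starIndices s t α' β' ↔ α = α' ∧ β = β') := by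
    intro α' β' hα' hβ'
    constructor
    · rintro ⟨j', hj', h⟩
      exact (star_index_injective hs ht hst hj hj' hα hβ hα' hβ' (neg_inj.1 h)).2
    · rintro ⟨rfl, rfl⟩
      exact ⟨j, hj, rfl⟩
  rw [torusSign_eq, h _ _ (by simp) (by simp), h _ _ (by simp) (by simp), h _ _ (by simp) (by simp),
    h _ _ (by simp) (by simp)]
  rcases hα with rfl | rfl <;> rcases hβ with rfl | rfl <;> norm_num

lemma exists_star_index {m : ℤ} (hm : torusSign s t m ≠ 0) :
    ∃ j α β : ℤ, Odd j ∧ (α = 1 ∨ α = -1) ∧ (β = 1 ∨ β = -1) ∧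
      m = -(s * t * j + s * α + t * β) := by
  rw [torusSign_eq] at hm
  split_ifs at hm with h1 h2
  · rcases h1 with ⟨j, hj, h⟩ | ⟨j, hj, h⟩
    · exact ⟨j, -1, -1, hj, by simp, by simp, h⟩
    · exact ⟨j, 1, 1, hj, by simp, by simp, h⟩
  · rcases h2 with ⟨j, hj, h⟩ | ⟨j, hj, h⟩
    · exact ⟨j, -1, 1, hj, by simp, by simp, h⟩
    · exact ⟨j, 1, -1, hj, by simp, by simp, h⟩
  · exact absurd rfl hm

end

/-! ### Formal sums -/

lemma isPWO_of_finite_Iic {S : Set ℚ} (h : ∀ N, (S ∩ Set.Iic N).Finite) : S.IsPWO := by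
  rw [Set.isPWO_iff_isWF, Set.isWF_iff_no_descending_seq]
  intro f hf hmem
  have hinf : (Set.range f).Infinite := Set.infinite_range_of_injective hf.injective
  refine hinf ((h (f 0)).subset ?_)
  rintro _ ⟨n, rfl⟩
  exact ⟨hmem n, hf.antitone (Nat.zero_le n)⟩

/-- Finitely many exponents below each bound give both well-ordering and finiteness at each power of
`q`. -/
lemma exists_isFormalSum_single {ι : Type} (e : ι → ℚ) (c : ι → LaurentPolynomial ℚ)
    (h : ∀ N, {i | e i ≤ N}.Finite) :
    ∃ F, IsFormalSum (fun i => HahnSeries.single (e i) (c i)) F := by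
  have hsupp : ∀ i g, (HahnSeries.single (e i) (c i)).coeff g ≠ 0 → g = e i := fun i g hg => by
    by_contra hne
    exact hg (HahnSeries.coeff_single_of_ne hne)
  refine ⟨_, ⟨fun i => HahnSeries.single (e i) (c i), ?_, fun g => ?_⟩, fun i => rfl, rfl⟩
  · refine isPWO_of_finite_Iic fun N => ((h N).image e).subset ?_
    rintro g ⟨hg, hgN⟩
    obtain ⟨i, hi⟩ := Set.mem_iUnion.1 hg
    obtain rfl := hsupp i g hi
    exact ⟨i, hgN, rfl⟩
  · exact (h g).subset fun i hi => (hsupp i g hi).ge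

/-- Reindexing of formal sums: the members of one family are zero or correspond bijectively to
members of the other. -/
lemma IsFormalSum.reindex {ι κ : Type} {f : ι → QSeries} {g : κ → QSeries} {F : QSeries}
    (hg : IsFormalSum g F) (R : Set ι) (φ : ι → κ) (hR : ∀ i ∉ R, f i = 0)
    (hf : ∀ i ∈ R, f i = g (φ i)) (hinj : R.InjOn φ) (hsurj : ∀ k, g k ≠ 0 → ∃ i ∈ R, φ i = k) :
    IsFormalSum f F := by
  obtain ⟨G, hG, rfl⟩ := hg
  have hmem : ∀ i x, (f i).coeff x ≠ 0 → i ∈ R := fun i x hx => by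
    by_contra hi
    simp [hR i hi] at hx
  have hbij : ∀ x, Set.BijOn φ {i | (f i).coeff x ≠ 0} {k | (g k).coeff x ≠ 0} := by
    intro x
    refine ⟨fun i hi => ?_, hinj.mono fun i hi => hmem i x hi, fun k hk => ?_⟩
    · have : (f i).coeff x ≠ 0 := hi
      rwa [hf i (hmem i x hi)] at this
    · obtain ⟨i, hi, rfl⟩ := hsurj k fun h0 => hk (by simp [h0])
      exact ⟨i, by simpa [hf i hi] using hk, rfl⟩
  refine ⟨⟨f, G.isPWO_iUnion_support.mono ?_, fun x => ?_⟩, fun i => rfl, ?_⟩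
  · refine Set.iUnion_subset fun i x hx => Set.mem_iUnion.2 ⟨φ i, ?_⟩
    rw [hG, ← hf i (hmem i x hx)]
    exact hx
  · refine Set.Finite.of_finite_image ?_ (hbij x).injOn
    rw [(hbij x).image_eq]
    have := G.finite_co_support x
    simpa [hG, Function.HasFiniteSupport, Function.support] using this
  · ext1
    funext x
    rw [HahnSeries.SummableFamily.coeff_hsum, HahnSeries.SummableFamily.coeff_hsum]
    simp only [hG, HahnSeries.SummableFamily.coe_mk]
    rw [← finsum_mem_support, ← finsum_mem_support (fun k => (g k).coeff x)]
    exact finsum_mem_eq_of_bijOn φ (hbij x) fun i hi => by rw [hf i (hmem i x hi)]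

lemma finsum_int_eq {Q : Type*} [AddCommMonoid Q] (h : ℤ → Q) (h0 : h 0 = 0)
    (hfin : (Function.support h).Finite) :
    ∑ᶠ m, h m = ∑ᶠ m : {m : ℕ // 1 ≤ m}, (h m.1 + h (-m.1)) := by
  have hp : Function.Injective fun m : {m : ℕ // 1 ≤ m} => (m.1 : ℤ) := fun a b hab => by
    simpa [Subtype.ext_iff] using hab
  have hn : Function.Injective fun m : {m : ℕ // 1 ≤ m} => -(m.1 : ℤ) := fun a b hab => by
    simpa [Subtype.ext_iff] using hab
  rw [finsum_add_distrib (hfin.preimage hp.injOn) (hfin.preimage hn.injOn),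
    ← finsum_mem_range (f := h) hp, ← finsum_mem_range (f := h) hn,
    ← finsum_mem_union' _ (hfin.subset Set.inter_subset_right) (hfin.subset Set.inter_subset_right),
    ← finsum_mem_univ]
  · refine finsum_mem_inter_support_eq' _ _ _ fun m hm => ⟨fun _ => ?_, fun _ => trivial⟩
    rcases lt_trichotomy m 0 with h' | rfl | h'
    · exact .inr ⟨⟨m.natAbs, by omega⟩, by simp only; omega⟩
    · exact absurd h0 hm
    · exact .inl ⟨⟨m.natAbs, by omega⟩, by simp only; omega⟩
  · rw [Set.disjoint_left]
    rintro _ ⟨a, rfl⟩ ⟨b, hb⟩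
    have := a.2
    have := b.2
    simp only at hb
    omega

/-- `½ sgn(m) ε_m x^{m/2} q^{m² / (4st) + κ}`. -/
noncomputable def torusMonomial (s t : ℕ) (κ : ℚ) (m : ℤ) : QSeries :=
  HahnSeries.single ((m : ℚ) ^ 2 / (4 * s * t) + κ)
    (LaurentPolynomial.C (1 / 2 * (m.sign * torusSign s t m : ℤ) : ℚ) * LaurentPolynomial.T m)

section

variable {s t : ℕ}

lemma exists_isFormalSum_torusTerm (hs : 0 < s) (ht : 0 < t) :
    ∃ S, IsFormalSum (fun m : {m : ℕ // 1 ≤ m} => torusTerm s t m.1) S := by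
  refine exists_isFormalSum_single _ _ fun N => ?_
  have hs' : (0 : ℚ) < s := by exact_mod_cast hs
  have ht' : (0 : ℚ) < t := by exact_mod_cast ht
  refine Set.Finite.of_finite_image (f := Subtype.val) ?_ Subtype.val_injective.injOn
  refine (Set.finite_Iic ⌈N * (4 * s * t) + ((s : ℚ) * t - s - t) ^ 2⌉₊).subset ?_
  rintro _ ⟨m, hm, rfl⟩
  simp only [Set.mem_ofPred_eq, Set.mem_Iic] at hm ⊢
  rw [div_le_iff₀ (by positivity)] at hm
  have h1 : (1 : ℚ) ≤ m.1 := by exact_mod_cast m.2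
  have h2 : (m.1 : ℚ) ≤ N * (4 * s * t) + ((s : ℚ) * t - s - t) ^ 2 := by nlinarith
  exact_mod_cast h2.trans (Nat.le_ceil _)

lemma exists_isFormalSum_torusMonomial (hs : 0 < s) (ht : 0 < t) (κ : ℚ) :
    ∃ S, IsFormalSum (torusMonomial s t κ) S := by
  refine exists_isFormalSum_single _ _ fun N => ?_
  have hs' : (0 : ℚ) < s := by exact_mod_cast hs
  have ht' : (0 : ℚ) < t := by exact_mod_cast ht
  refine (Set.finite_Icc (-⌈(N - κ) * (4 * s * t)⌉) ⌈(N - κ) * (4 * s * t)⌉).subset ?_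
  intro m hm
  simp only [Set.mem_ofPred_eq, ← le_sub_iff_add_le] at hm
  rw [div_le_iff₀ (by positivity)] at hm
  have h1 : m ^ 2 ≤ ⌈(N - κ) * (4 * s * t)⌉ := by
    exact_mod_cast hm.trans (Int.le_ceil _)
  constructor <;> linarith [Int.le_self_sq m, Int.le_self_sq (-m), neg_sq m]

/-- `ε` is even and `sgn` is odd, so the monomials of `m` and `-m` combine into `x^{m/2} -
x^{-m/2}`. -/
lemma single_mul_torusTerm (hs : 0 < s) (ht : 0 < t) (κ : ℚ) {m : ℕ} (hm : 1 ≤ m) :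
    HahnSeries.single (((s : ℚ) * t - s - t) ^ 2 / (4 * s * t) + κ)
        (LaurentPolynomial.C (1 / 2 : ℚ)) * torusTerm s t m =
      torusMonomial s t κ m + torusMonomial s t κ (-m) := by
  have hs' : (s : ℚ) ≠ 0 := by exact_mod_cast hs.ne'
  have ht' : (t : ℚ) ≠ 0 := by exact_mod_cast ht.ne'
  have hsign : Int.sign (m : ℤ) = 1 := Int.sign_eq_one_of_pos (by exact_mod_cast hm)
  have hexp : ((s : ℚ) * t - s - t) ^ 2 / (4 * s * t) + κ +
      ((m : ℚ) ^ 2 - ((s : ℚ) * (t : ℚ) - (s : ℚ) - (t : ℚ)) ^ 2) / (4 * (s : ℚ) * (t : ℚ)) =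
      (m : ℚ) ^ 2 / (4 * s * t) + κ := by
    field_simp
    ring
  rw [torusTerm, HahnSeries.single_mul_single, torusMonomial, torusMonomial, torusSign_neg,
    Int.sign_neg, hsign, hexp]
  push_cast
  rw [neg_sq, ← HahnSeries.single_add]
  congr 1
  simp only [one_mul, neg_mul, mul_neg, map_neg, map_mul]
  ring

lemma IsFormalSum.torusMonomial (hs : 0 < s) (ht : 0 < t) (κ : ℚ) {S : QSeries}
    (hS : IsFormalSum (fun m : {m : ℕ // 1 ≤ m} => torusTerm s t m.1) S) :
    IsFormalSum (torusMonomial s t κ)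
      (HahnSeries.single (((s : ℚ) * t - s - t) ^ 2 / (4 * s * t) + κ)
        (LaurentPolynomial.C (1 / 2 : ℚ)) * S) := by
  obtain ⟨S, hS, rfl⟩ := hS
  obtain ⟨_, G, hG, -⟩ := exists_isFormalSum_torusMonomial hs ht κ
  refine ⟨G, hG, ?_⟩
  rw [← HahnSeries.SummableFamily.hsum_smul]
  ext1
  funext x
  rw [HahnSeries.SummableFamily.coeff_hsum, HahnSeries.SummableFamily.coeff_hsum,
    finsum_int_eq _ (by simp [hG, PlumbedKnot.torusMonomial]) (G.finite_co_support x)]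
  refine finsum_congr fun m => ?_
  rw [HahnSeries.SummableFamily.smul_apply, HahnSeries.of_symm_smul_of_eq_mul, hS,
    single_mul_torusTerm hs ht κ m.2, hG, hG, HahnSeries.coeff_add]

end

/-! ### The terms of the series of a torus knot -/

section

variable {s t : ℕ} {A B : List ℤ}

lemma prod_leg_pvCoeff {p : ℕ} (hp : 0 < p) {l : Fin p → ℤ} {α : ℤ} (hα : α = 1 ∨ α = -1)
    (hl : ∀ i, l i = if i.val + 1 = p then α else 0) :
    ∏ i, pvCoeff (2 - ((if i.val + 1 = p then 1 else 2 : ℕ) : ℤ)) (-(l i)) = -α := by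
  rw [Finset.prod_eq_single ⟨p - 1, by omega⟩]
  · rw [hl, if_pos (by simp; omega), if_pos (by simp; omega),
      show (2 - ((1 : ℕ) : ℤ)) = 1 by norm_num, pvCoeff_one]
    rcases hα with rfl | rfl <;> norm_num
  · intro i _ hi
    have : i.val + 1 ≠ p := fun h => hi (Fin.ext (by simp; omega))
    rw [hl, if_neg this, if_neg this, show (2 - ((2 : ℕ) : ℤ)) = 0 by norm_num, pvCoeff_zero]
    simp
  · simp

lemma exists_of_prod_leg_pvCoeff_ne_zero {p : ℕ} (hp : 0 < p) {l : Fin p → ℤ}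
    (h : ∏ i, pvCoeff (2 - ((if i.val + 1 = p then 1 else 2 : ℕ) : ℤ)) (-(l i)) ≠ 0) :
    ∃ α : ℤ, (α = 1 ∨ α = -1) ∧ ∀ i, l i = if i.val + 1 = p then α else 0 := by
  have h' := fun i => Finset.prod_ne_zero_iff.1 h i (Finset.mem_univ i)
  refine ⟨l ⟨p - 1, by omega⟩, ?_, fun i => ?_⟩
  · have := h' ⟨p - 1, by omega⟩
    rw [if_pos (by simp; omega), show (2 - ((1 : ℕ) : ℤ)) = 1 by norm_num, pvCoeff_one] at this
    by_contra! hne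
    rw [if_neg (by omega), if_neg (by omega)] at this
    simp at this
  · split_ifs with hi
    · congr 1
      exact Fin.ext (by simp; omega)
    · have := h' i
      rw [if_neg hi, show (2 - ((2 : ℕ) : ℤ)) = 0 by norm_num, pvCoeff_zero] at this
      by_contra hne
      rw [if_neg (by omega)] at this
      exact this rfl

lemma prod_erase_knot {p r : ℕ} [DecidableEq (StarVert p r)] (g : StarVert p r → ℚ) :
    ∏ v ∈ Finset.univ.erase knot, g v = g center * ((∏ i, g (legA i)) * ∏ j, g (legB j)) := by
  have h1 : ∏ v ∈ Finset.univ.erase (knot : StarVert p r), g v =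
      ∏ v ∈ Finset.univ.erase (knot : StarVert p r), if v = knot then 1 else g v :=
    Finset.prod_congr rfl fun v hv => by rw [if_neg (Finset.ne_of_mem_erase hv)]
  rw [h1, Finset.prod_erase _ (by simp), Fintype.prod_sum_type, Fintype.prod_sum_type,
    Fintype.prod_sum_type]
  simp

/-- The vectors `l = M (2k + b)` which contribute to the series. -/
structure IsContributing (l : StarVert A.length B.length → ℤ) (α β : ℤ) : Prop where
  ends : EndSupported l α β
  signA : α = 1 ∨ α = -1
  signB : β = 1 ∨ β = -1
  odd : Odd (l center)

lemma prod_pvCoeff_eq (hA : A ≠ []) (hB : B ≠ []) [DecidableEq (StarVert A.length B.length)]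
    (l : StarVert A.length B.length → ℤ) :
    ∏ v ∈ Finset.univ.erase knot, pvCoeff (2 - ((torusGraph s t A B).deg v : ℤ)) (-(l v)) =
      (if Odd (l center) then ((l center).sign : ℚ) / 2 else 0) *
      ((∏ i : Fin A.length, pvCoeff (2 - ((if i.val + 1 = A.length then 1 else 2 : ℕ) : ℤ))
          (-(l (legA i)))) *
        ∏ i : Fin B.length, pvCoeff (2 - ((if i.val + 1 = B.length then 1 else 2 : ℕ) : ℤ))
          (-(l (legB i)))) := by
  rw [prod_erase_knot, deg_center hA hB, show (2 - ((3 : ℕ) : ℤ)) = -1 by norm_num, pvCoeff_neg_one]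
  simp only [deg_legA, deg_legB, odd_neg, Int.sign_neg, Int.cast_neg, neg_neg]

lemma IsContributing.prod_pvCoeff (hA : A ≠ []) (hB : B ≠ [])
    [DecidableEq (StarVert A.length B.length)] {l : StarVert A.length B.length → ℤ} {α β : ℤ}
    (h : IsContributing l α β) :
    ∏ v ∈ Finset.univ.erase knot, pvCoeff (2 - ((torusGraph s t A B).deg v : ℤ)) (-(l v)) =
      1 / 2 * ((l center).sign * (α * β) : ℤ) := by
  rw [prod_pvCoeff_eq hA hB, if_pos h.odd,
    prod_leg_pvCoeff (List.length_pos_iff.2 hA) h.signA h.ends.legA,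
    prod_leg_pvCoeff (List.length_pos_iff.2 hB) h.signB h.ends.legB]
  push_cast
  ring

lemma exists_isContributing (hA : A ≠ []) (hB : B ≠ [])
    [DecidableEq (StarVert A.length B.length)] {l : StarVert A.length B.length → ℤ}
    (h : ∏ v ∈ Finset.univ.erase knot,
      pvCoeff (2 - ((torusGraph s t A B).deg v : ℤ)) (-(l v)) ≠ 0) :
    ∃ α β, IsContributing l α β := by
  rw [prod_pvCoeff_eq hA hB] at h
  obtain ⟨α, hα, hlA⟩ := exists_of_prod_leg_pvCoeff_ne_zero (List.length_pos_iff.2 hA)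
    (left_ne_zero_of_mul (right_ne_zero_of_mul h))
  obtain ⟨β, hβ, hlB⟩ := exists_of_prod_leg_pvCoeff_ne_zero (List.length_pos_iff.2 hB)
    (right_ne_zero_of_mul (right_ne_zero_of_mul h))
  refine ⟨α, β, ⟨hlA, hlB⟩, hα, hβ, ?_⟩
  by_contra hodd
  simp [hodd] at h

/-- The shift of the exponents of `q`. -/
noncomputable def expShift (s t : ℕ) (A B : List ℤ) : ℚ :=
  -((chainMatrix (A.map Neg.neg) 0 1 : ℚ) / t + (chainMatrix (B.map Neg.neg) 0 1 : ℚ) / s) / 4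

lemma TorusLegs.term_eq (h : TorusLegs s t A B) (hs : 1 < s) (ht : 1 < t) (hst : Nat.Coprime s t)
    {b k : StarVert A.length B.length → ℤ} {α β : ℤ}
    (hl : IsContributing ((torusGraph s t A B).M.mulVec ((2 : ℤ) • k + b)) α β) :
    (torusGraph s t A B).term b k = torusMonomial s t (expShift s t A B)
      ((torusGraph s t A B).M.mulVec ((2 : ℤ) • k + b) knot) := by
  have hs' : (s : ℚ) ≠ 0 := by exact_mod_cast (by omega : s ≠ 0)
  have ht' : (t : ℚ) ≠ 0 := by exact_mod_cast (by omega : t ≠ 0)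
  have hα : α ^ 2 = 1 := by rcases hl.signA with rfl | rfl <;> rfl
  have hβ : β ^ 2 = 1 := by rcases hl.signB with rfl | rfl <;> rfl
  have hdot := h.dotProduct_mulVec (by omega) (by omega) hα hβ hl.ends
  have hcoef : Int.sign ((torusGraph s t A B).M.mulVec ((2 : ℤ) • k + b) knot) *
      torusSign s t ((torusGraph s t A B).M.mulVec ((2 : ℤ) • k + b) knot) =
      ((torusGraph s t A B).M.mulVec ((2 : ℤ) • k + b) center).sign * (α * β) := by
    rw [h.mulVec_knot hl.ends, sign_star_index hs ht hst hl.odd hl.signA hl.signB,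
      torusSign_star_index hs ht hst hl.odd hl.signA hl.signB]
    ring
  simp only [Graph.term, torusMonomial, torusGraph_root, deg_knot, Nat.sub_self, pow_zero, mul_one]
  rw [@IsContributing.prod_pvCoeff s t A B h.neA h.neB (fun a b => Classical.propDecidable (a = b))
    _ _ _ hl, hcoef, hdot]
  congr 2
  rw [expShift]
  field_simp
  ring

lemma TorusLegs.term_eq_zero (h : TorusLegs s t A B) {b k : StarVert A.length B.length → ℤ}
    (hl : ¬∃ α β, IsContributing ((torusGraph s t A B).M.mulVec ((2 : ℤ) • k + b)) α β) :
    (torusGraph s t A B).term b k = 0 := by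
  simp only [Graph.term, torusGraph_root]
  rw [not_imp_comm.1 (@exists_isContributing s t A B h.neA h.neB
    (fun a b => Classical.propDecidable (a = b)) _) hl]
  simp

/-- The index at `v₀` determines `j, α, β`, hence all of `M y`. As `M` has a kernel, `y` is
recovered only because its entry at `v₀` is prescribed. -/
lemma IsContributing.eq_of_knot_eq (h : TorusLegs s t A B) (hs : 1 < s) (ht : 1 < t)
    (hst : Nat.Coprime s t) {y y' : StarVert A.length B.length → ℤ} {α β α' β' : ℤ}
    (hl : IsContributing ((torusGraph s t A B).M.mulVec y) α β)
    (hl' : IsContributing ((torusGraph s t A B).M.mulVec y') α' β')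
    (hyk : y knot = y' knot)
    (hk : (torusGraph s t A B).M.mulVec y knot = (torusGraph s t A B).M.mulVec y' knot) :
    y = y' := by
  have hk' := hk
  rw [h.mulVec_knot hl.ends, h.mulVec_knot hl'.ends, neg_inj] at hk'
  obtain ⟨hj, rfl, rfl⟩ := star_index_injective hs ht hst hl.odd hl'.odd hl.signA hl.signB
    hl'.signA hl'.signB hk'
  have heq : (torusGraph s t A B).M.mulVec y = (torusGraph s t A B).M.mulVec y' := by
    funext v
    rcases v with (_ | _) | (i | i)
    · exact hj
    · exact hk
    · exact (hl.ends.legA i).trans (hl'.ends.legA i).symm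
    · exact (hl.ends.legB i).trans (hl'.ends.legB i).symm
  refine sub_eq_zero.1 (h.eq_zero (y - y') (by simp [hyk]) fun v _ => ?_)
  have := congrFun (Matrix.mulVec_sub (torusGraph s t A B).M y y') v
  rw [heq, sub_self] at this
  exact this

lemma TorusLegs.exists_isContributing (h : TorusLegs s t A B)
    {b : StarVert A.length B.length → ℤ}
    (hb : (torusGraph s t A B).IsRelSpinc ((torusGraph s t A B).M.mulVec b)) (n : ℤ)
    {j α β : ℤ} (hj : Odd j) (hα : α = 1 ∨ α = -1) (hβ : β = 1 ∨ β = -1) :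
    ∃ k : StarVert A.length B.length → ℤ, k knot = n ∧
      IsContributing ((torusGraph s t A B).M.mulVec ((2 : ℤ) • k + b)) α β ∧
      (torusGraph s t A B).M.mulVec ((2 : ℤ) • k + b) center = j := by
  let l : StarVert A.length B.length → ℤ := Sum.elim (fun _ => j)
    (Sum.elim (fun i => if i.val + 1 = A.length then α else 0)
      (fun i => if i.val + 1 = B.length then β else 0))
  -- Both vectors have the parity of the degrees, so half their difference is an integral right-hand
  -- side.
  have hpar : ∀ v, v ≠ knot → (2 : ℤ) ∣ l v - (torusGraph s t A B).M.mulVec b v := by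
    intro v hv
    have h1 := (hb v).symm.dvd
    have h2 : (2 : ℤ) ∣ l v - (torusGraph s t A B).deg v := by
      rcases v with (_ | _) | (i | i)
      · rw [deg_center h.neA h.neB]
        obtain ⟨a, rfl⟩ := hj
        exact ⟨a - 1, by simp [l]; ring⟩
      · exact absurd rfl hv
      · rw [deg_legA]
        simp only [l, Sum.elim_inr, Sum.elim_inl]
        split_ifs
        · rcases hα with rfl | rfl <;> norm_num
        · norm_num
      · rw [deg_legB]
        simp only [l, Sum.elim_inr]
        split_ifs
        · rcases hβ with rfl | rfl <;> norm_num
        · norm_num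
    rw [← sub_sub_sub_cancel_right _ _ ((torusGraph s t A B).deg v : ℤ)]
    exact dvd_sub h2 h1
  obtain ⟨z, hz0, hz⟩ := h.exists_mulVec_eq fun v => (l v - (torusGraph s t A B).M.mulVec b v) / 2
  -- Adding `n • w` gives the summation vector the entry `n` at `v₀` without changing `M y`; this is
  -- why the series does not depend on `n`.
  obtain ⟨w, hw1, hw⟩ := h.exists_kernel
  have hM : ∀ v, v ≠ knot →
      (torusGraph s t A B).M.mulVec ((2 : ℤ) • (z + n • w) + b) v = l v := by
    intro v hv
    rw [Matrix.mulVec_add, Matrix.mulVec_smul, Matrix.mulVec_add, Matrix.mulVec_smul, hw]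
    simp only [smul_zero, add_zero, Pi.add_apply, Pi.smul_apply, smul_eq_mul, hz v hv]
    rw [Int.mul_ediv_cancel' (hpar v hv)]
    ring
  refine ⟨z + n • w, by simp [hz0, hw1], ⟨⟨fun i => ?_, fun i => ?_⟩, hα, hβ, ?_⟩, ?_⟩
  · exact hM _ (by simp)
  · exact hM _ (by simp)
  · rw [hM _ (by simp)]; exact hj
  · exact hM _ (by simp)

lemma TorusLegs.isFormalSum_term (h : TorusLegs s t A B) (hs : 1 < s) (ht : 1 < t)
    (hst : Nat.Coprime s t) {b : StarVert A.length B.length → ℤ}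
    (hb : (torusGraph s t A B).IsRelSpinc ((torusGraph s t A B).M.mulVec b)) (n : ℤ) {S : QSeries}
    (hS : IsFormalSum (torusMonomial s t (expShift s t A B)) S) :
    IsFormalSum (fun k : {k : StarVert A.length B.length → ℤ // k knot = n} =>
      (torusGraph s t A B).term b k.1) S := by
  refine hS.reindex
    {k | ∃ α β, IsContributing ((torusGraph s t A B).M.mulVec ((2 : ℤ) • k.1 + b)) α β}
    (fun k => (torusGraph s t A B).M.mulVec ((2 : ℤ) • k.1 + b) knot) (fun k hk => ?_)
    (fun k hk => ?_) ?_ fun m hm => ?_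
  · exact h.term_eq_zero hk
  · obtain ⟨α, β, hk⟩ := hk
    exact h.term_eq hs ht hst hk
  · rintro k ⟨α, β, hk⟩ k' ⟨α', β', hk'⟩ heq
    have := hk.eq_of_knot_eq h hs ht hst hk' (by simp [k.2, k'.2]) heq
    have h2 := smul_right_injective _ (two_ne_zero' ℤ) (add_right_cancel this)
    exact Subtype.ext h2
  · obtain ⟨j, α, β, hj, hα, hβ, rfl⟩ := exists_star_index (s := s) (t := t) (m := m)
      fun h0 => hm (by simp [torusMonomial, h0])
    obtain ⟨k, hkn, hk, hkj⟩ := h.exists_isContributing hb n hj hα hβ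
    refine ⟨⟨k, hkn⟩, ⟨α, β, hk⟩, ?_⟩
    simp only
    rw [h.mulVec_knot hk.ends, hkj]

/-! ### The prefactor -/

lemma sum_map_neg_sub_three (L : List ℤ) :
    ((L.map Neg.neg).map fun a => a - 3).sum = -L.sum - 3 * L.length := by
  induction L with
  | nil => simp
  | cons a L ih => simp only [List.map_cons, List.sum_cons, ih, List.length_cons]; push_cast; ring

lemma sum_weight : ∑ v, (torusGraph s t A B).weight v = -1 - s * t + A.sum + B.sum := by
  have hsum : ∀ L : List ℤ, ∑ i : Fin L.length, L[i.val] = L.sum := fun L => by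
    conv_rhs => rw [← List.ofFn_getElem (xs := L), List.sum_ofFn]
  have hA := hsum A
  have hB := hsum B
  simp only [Fintype.sum_sum_type, torusGraph, List.get_eq_getElem, hA, hB]
  simp
  ring

lemma TorusLegs.prefactor_mul (h : TorusLegs s t A B) (hs : 1 < s) (ht : 1 < t)
    (hneg : (torusGraph s t A B).HatNegDef) :
    (torusGraph s t A B).prefactor *
      HahnSeries.single (((s : ℚ) * t - s - t) ^ 2 / (4 * s * t) + expShift s t A B)
        (LaurentPolynomial.C (1 / 2 : ℚ)) =
      HahnSeries.single (((s : ℚ) - 1) * ((t : ℚ) - 1) / 2) (LaurentPolynomial.C (1 / 2 : ℚ)) := by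
  have hs' : (s : ℚ) ≠ 0 := by exact_mod_cast (by omega : s ≠ 0)
  have ht' : (t : ℚ) ≠ 0 := by exact_mod_cast (by omega : t ≠ 0)
  obtain ⟨w, hw1, hw⟩ := h.exists_kernel
  obtain ⟨hpos, hsig⟩ := Graph.posIndex_signature hneg hw1 hw
  have hlegs := h.posA.sum_two_legs h.posB (by rw [h.detA, h.detB]; exact h.det_chain)
  rw [h.detA, h.detB, sum_map_neg_sub_three, sum_map_neg_sub_three] at hlegs
  have hweight : ∑ v, ((torusGraph s t A B).weight v : ℚ) = -1 - s * t + A.sum + B.sum := by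
    exact_mod_cast sum_weight (s := s) (t := t) (A := A) (B := B)
  have hexp : (3 * ((torusGraph s t A B).signature : ℚ) -
        ∑ v, ((torusGraph s t A B).weight v : ℚ)) / 4 +
      (((s : ℚ) * t - s - t) ^ 2 / (4 * s * t) + expShift s t A B) =
      ((s : ℚ) - 1) * ((t : ℚ) - 1) / 2 := by
    -- The quotients `s / t` and `t / s` split off here are the ones occurring in
    -- `SuffixPos.sum_two_legs`.
    have hsq : ((s : ℚ) * t - s - t) ^ 2 / (4 * s * t) =
        (s * t - 2 * s - 2 * t + 2 + s / t + t / s) / 4 := by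
      field_simp
      ring
    rw [hsig, hweight, expShift, hsq]
    simp only [Fintype.card_sum, Fintype.card_unit, Fintype.card_fin]
    generalize A.sum = a at *
    generalize B.sum = b at *
    rw [sub_div, sub_div] at hlegs
    push_cast at hlegs ⊢
    linear_combination hlegs / 4
  rw [Graph.prefactor, HahnSeries.single_mul_single, hexp, hpos]
  simp

end

end PlumbedKnot


theorem theorem1p3 (s t : ℕ) (hs : 1 < s) (ht : 1 < t) (hst : Nat.Coprime s t) :
    (∃ A B : List ℤ, PlumbedKnot.IsTorusDiagram s t A B) ∧
    ∀ A B : List ℤ, PlumbedKnot.IsTorusDiagram s t A B →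
      ∃ F : PlumbedKnot.QSeries,
        (PlumbedKnot.torusGraph s t A B).IsKnotSeries F ∧
        ∃ S : PlumbedKnot.QSeries,
          PlumbedKnot.IsFormalSum
            (fun m : {m : ℕ // 1 ≤ m} => PlumbedKnot.torusTerm s t m.1) S ∧
          F = HahnSeries.single (((s : ℚ) - 1) * ((t : ℚ) - 1) / 2)
                (LaurentPolynomial.C (1 / 2 : ℚ)) * S := by
  refine ⟨PlumbedKnot.exists_isTorusDiagram hs ht hst, fun A B hAB => ?_⟩
  have h := hAB.torusLegs hs ht hst
  obtain ⟨S, hS⟩ := PlumbedKnot.exists_isFormalSum_torusTerm (s := s) (t := t) (by omega) (by omega)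
  -- The final `rfl` fixes `F` as the explicit series, before any `a`, `b` or `n` is chosen;
  -- independence of these choices is thereby part of what is proved.
  refine ⟨_, ⟨h.isSeifertFramed hAB.negDef, h.exists_isSelfConj hst, fun a ha =>
    ⟨ha.exists_eq, ?_⟩⟩, S, hS, rfl⟩
  rintro b - rfl n
  refine ⟨_, h.isFormalSum_term hs ht hst ha.1 n
    (hS.torusMonomial (by omega) (by omega) (PlumbedKnot.expShift s t A B)), ?_⟩
  rw [← mul_assoc, h.prefactor_mul hs ht hAB.negDef]
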